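/- Fix a real parameter $\alpha<\tfrac12$. For $\nu\in\mathbb C$ put \[ \boldsymbol W_{\alpha,\nu}(x)=2^{\alpha}x^{2\alpha}e^{\frac1{4x^2}}\,W_{\alpha,\nu}\!\Bigl(\frac1{2x^2}\Bigr)\quad(x>0),\qquad \boldsymbol W_{\alpha,\nu}(0)=1, \] where $W_{\alpha,\nu}$ is the Whittaker function of the second kind. For $\operatorname{Re}\nu\ge 0$ and $z>0$ it is given by \[ W_{\alpha,\nu}(z)=\frac{e^{-z/2}z^{\frac12+\nu}}{\Gamma(\frac12-\alpha+\nu)}\int_0^\infty e^{-zt}\,t^{\nu-\alpha-\frac12}(1+t)^{\nu+\alpha-\frac12}\,dt , \] and $W_{\alpha,-\nu}=W_{\alpha,\nu}$. For $\lambda\ge0$ let $\Delta_\lambda=\sqrt{(\frac12-\alpha)^2-\lambda}$ (a nonnegative real number or $i$ times a positive one). Let $\mathcal M_b[0,\infty)$ and $\mathcal P[0,\infty)$ be the sets of finite positive Borel measures and of Borel probability measures on $[0,\infty)$, and let $\mu_n\overset{w}{\to}\mu$ denote weak convergence (against bounded continuous functions). The index Whittaker transform of $\mu\in\mathcal M_b[0,\infty)$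 is \[ \widehat\mu(\lambda)=\int_{[0,\infty)}\boldsymbol W_{\alpha,\Delta_\lambda}(x)\,\mu(dx),\qquad \lambda\ge0 . \] The integrand is $\mu$-integrable for every $\mu\in\mathcal M_b[0,\infty)$ and $\lambda\ge 0$, and the following hold. (i) For each $\mu\in\mathcal M_b[0,\infty)$, $\widehat\mu$ is uniformly continuous on $[0,\infty)$. Moreover, if $\{\mu_j:j\in J\}\subseteq\mathcal P[0,\infty)$ is such that the family of restrictions of the $\mu_j$ to $(0,\infty)$ is tight (for every $\varepsilon>0$ there is a compact $K\subset[0,\infty)$ with $\mu_j((0,\infty)\setminus K)\le\varepsilon$ for all $j\in J$; this holds in particular when $K$ can be chosen inside $(0,\infty)$), then $\{\widehat{\mu_j}:j\in J\}$ is uniformly equicontinuous on $[0,\infty)$. (ii) Each $\mu\in\mathcal M_b[0,\infty)$ is uniquely determined by $\widehat\mu$: if $\mu_1,\mu_2\in\mathcal M_b[0,\infty)$ and $\widehat{\mu_1}(\lambda)=\widehat{\mu_2}(\lambda)$ for all $\lambda\ge0$, then $\mu_1=\mu_2$. (iii) If $\mu_n,\mu\in\mathcal M_b[0,\infty)$ and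 $\mu_n\overset{w}{\to}\mu$, then $\widehat{\mu_n}\to\widehat\mu$ uniformly on compact subsets of $[0,\infty)$. (iv) If $\mu_n\in\mathcal M_b[0,\infty)$ and $\widehat{\mu_n}(\lambda)\to f(\lambda)$ for every $\lambda\ge0$, where $f:[0,\infty)\to\mathbb R$ is continuous on a neighbourhood of $0$ in $[0,\infty)$, then there is $\mu\in\mathcal M_b[0,\infty)$ with $\mu_n\overset{w}{\to}\mu$ and $\widehat\mu(\lambda)=f(\lambda)$ for all $\lambda\ge0$. -/

import Mathlib

open MeasureTheory Filter Topology
open scoped NNReal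

noncomputable section

namespace IndexWhittaker

/-- Confluent hypergeometric function of the second kind (Tricomi function) `Ψ(a, c; z)` for
`0 < Re a` and `z > 0`, given there by its defining integral
`Γ(a)⁻¹ ∫₀^∞ e^{-zt} t^{a-1} (1+t)^{c-a-1} dt`. -/
def tricomi (a c : ℂ) (z : ℝ) : ℂ :=
  (Complex.Gamma a)⁻¹ *
    ∫ t in Set.Ioi (0 : ℝ),
      Complex.exp (-((z * t : ℝ) : ℂ)) * (t : ℂ) ^ (a - 1) * ((1 + t : ℝ) : ℂ) ^ (c - a - 1)

/-- `e^{-z/2} z^{1/2+μ} Ψ(1/2 + μ - κ, 1 + 2μ; z)`. -/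
def whittakerAux (κ : ℝ) (μ : ℂ) (z : ℝ) : ℂ :=
  Complex.exp (-((z / 2 : ℝ) : ℂ)) * (z : ℂ) ^ (1 / 2 + μ) *
    tricomi (1 / 2 + μ - κ) (1 + 2 * μ) z

/-- Whittaker function of the second kind `W_{κ,μ}(z)`, for real `κ < 1/2`, complex `μ` and `z > 0`.
It is even in `μ`; the sign of `μ` with `0 ≤ Re μ` is used so that the first parameter of the
Tricomi function has positive real part. -/
def whittakerW (κ : ℝ) (μ : ℂ) (z : ℝ) : ℂ :=
  if 0 ≤ μ.re then whittakerAux κ μ z else whittakerAux κ (-μ) z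

/-- The normalized function `𝑾_{α,ν}(x) = 2^α x^{2α} e^{1/(4x²)} W_{α,ν}(1/(2x²))` for `x > 0`,
with its continuous extension `𝑾_{α,ν}(0) = 1`. -/
def bW (α : ℝ) (ν : ℂ) (x : ℝ≥0) : ℂ :=
  if x = 0 then 1
  else (((2 : ℝ) ^ α * (x : ℝ) ^ (2 * α) * Real.exp (1 / (4 * (x : ℝ) ^ 2)) : ℝ) : ℂ) *
    whittakerW α ν (1 / (2 * (x : ℝ) ^ 2))

/-- `Δ_λ = √((1/2 - α)² - λ)`, the principal square root (nonnegative, or `i` times a positive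
number). -/
def Δ (α : ℝ) (l : ℝ≥0) : ℂ :=
  Complex.sqrt (((1 / 2 - α) ^ 2 - (l : ℝ) : ℝ) : ℂ)

/-- Index Whittaker transform of a measure on `[0,∞)`:
`μ̂(λ) = ∫_{[0,∞)} 𝑾_{α,Δ_λ}(x) μ(dx)` for `λ ≥ 0`. -/
def transform (α : ℝ) (μ : Measure ℝ≥0) (l : ℝ≥0) : ℂ :=
  ∫ x, bW α (Δ α l) x ∂μ

end IndexWhittaker

end

/-!
Put `a = 1/2 - α > 0`, `y = 2x²` and `A = a + ν`, `B = a - ν`. The substitution `s = zt` turns the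
integral defining `W_{α,ν}(1/(2x²))` into (`bW_eq_profile`)
`𝑾_{α,ν}(x) = Γ(A)⁻¹ ∫₀^∞ e^{-s} s^{A-1} (1+ys)^{-B} ds`,
which is also valid at `x = 0`.

*Estimates.* As a function `w` of `y`, this solves `y² w'' + (1 + (1+2a) y) w' + λ w = 0` with
`λ = a² - ν²` and `w(0) = 1` (`profile_ode`). The energy `λ|w|² + y²|w'|²` is nonincreasing, hence
`|w| ≤ 1` for every `λ ≥ 0`. The difference of the solutions for `λ` and `λ'` solves the same
equation with a right-hand side of size at most `|λ-λ'|`; its energy is at most `|λ-λ'|² y/2`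
(`energy_estimate`), and integrating the resulting bound on the derivative gives
`|𝑾_{α,Δ_λ}(x) - 𝑾_{α,Δ_λ'}(x)| ≤ min(2, 2x|λ-λ'|)` (`norm_bW_sub_le`). Integrating this against
measures yields uniform continuity, equicontinuity, and local uniformity in the weak limit.

*Uniqueness.* For `ν = iτ`, the quantity `Γ(a+iτ) μ̂(a²+τ²)` is the characteristic function at `τ`
of the image of `e^{-s} s^{a-1} (1+2x²s)^{-a} ds μ(dx)` under `(x, s) ↦ log (s + 2x²s²)`
(`charFun_logMeasure_eq_transform`), so the transform determines this image. Integrating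
`q^a e^{-r²q}` with `q = s + 2x²s²` against it, and rescaling `s`, one obtains
`∫₀^∞ e^{-cu} u^{2a-1} L(u) du` for all `c = r + 1/r ≥ 2`, where `L(u) = ∫ e^{-2x²u²} μ(dx)`
(`integral_logMeasure_exp_mul_exp`). Injectivity of the Laplace transform, which is
Stone–Weierstrass for exponentials (`ext_of_integral_exp_neg_mul_eq`), first gives `L` and then `μ`.

*Continuity theorem.* At `λ = 0` the transform is the total mass, and for `λ > 0` the integrand
tends to `0` at infinity, so `μ_n(R, ∞) ≤ 2 (μ̂_n(0) - Re μ̂_n(λ))` for `R` large depending on `λ`.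
Continuity of the limit at `0` therefore gives tightness; Prokhorov's theorem provides cluster
points and uniqueness identifies them.
-/

namespace IndexWhittaker

/-! ### Gamma averages of powers -/

/-- The integrand `e^{-s} s^{A-1} (1+ys)^{-B}`. -/
noncomputable def gammaKernel (A B : ℂ) (y s : ℝ) : ℂ :=
  (Real.exp (-s) : ℂ) * (s : ℂ) ^ (A - 1) * ((1 + y * s : ℝ) : ℂ) ^ (-B)

/-- `∫₀^∞ e^{-s} s^{A-1} (1+ys)^{-B} ds`; divided by `Γ(A)` it is the Borel sum of the divergent
hypergeometric series `₂F₀(A, B; ; -y)`. -/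
noncomputable def gammaAverage (A B : ℂ) (y : ℝ) : ℂ :=
  ∫ s in Set.Ioi (0 : ℝ), gammaKernel A B y s

lemma norm_gammaKernel (A B : ℂ) {y s : ℝ} (hy : 0 ≤ y) (hs : 0 < s) :
    ‖gammaKernel A B y s‖ = Real.exp (-s) * s ^ (A.re - 1) * (1 + y * s) ^ (-B.re) := by
  have h : 0 < 1 + y * s := by positivity
  rw [gammaKernel, norm_mul, norm_mul, Complex.norm_cpow_eq_rpow_re_of_pos hs,
    Complex.norm_cpow_eq_rpow_re_of_pos h, Complex.norm_real, Real.norm_of_nonneg (by positivity)]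
  simp

lemma norm_gammaKernel_le (A : ℂ) {B : ℂ} (hB : 0 ≤ B.re) {y s : ℝ} (hy : 0 ≤ y) (hs : 0 < s) :
    ‖gammaKernel A B y s‖ ≤ Real.exp (-s) * s ^ (A.re - 1) := by
  rw [norm_gammaKernel A B hy hs]
  refine mul_le_of_le_one_right (by positivity) ?_
  exact Real.rpow_le_one_of_one_le_of_nonpos (by nlinarith [mul_nonneg hy hs.le]) (by linarith)

@[fun_prop]
lemma measurable_gammaKernel (A B : ℂ) (y : ℝ) : Measurable (gammaKernel A B y) := by
  unfold gammaKernel; fun_prop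

/-- The Gamma integrand, which dominates `gammaKernel` uniformly in `y ≥ 0` when `Re B ≥ 0`. -/
lemma integrable_gammaBound {p : ℝ} (hp : 0 < p) :
    IntegrableOn (fun s : ℝ => Real.exp (-s) * s ^ (p - 1)) (Set.Ioi 0) :=
  Real.GammaIntegral_convergent hp

lemma integrable_gammaKernel {A B : ℂ} (hA : 0 < A.re) (hB : 0 ≤ B.re) {y : ℝ} (hy : 0 ≤ y) :
    IntegrableOn (gammaKernel A B y) (Set.Ioi 0) := by
  refine (integrable_gammaBound hA).mono' (by fun_prop) ?_
  filter_upwards [ae_restrict_mem measurableSet_Ioi] with s hs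
  exact norm_gammaKernel_le A hB hy hs

lemma hasDerivAt_ofReal_cpow_affine (c : ℂ) {b t x : ℝ} (h : 0 < b + t * x) :
    HasDerivAt (fun x : ℝ => ((b + t * x : ℝ) : ℂ) ^ c)
      (c * ((b + t * x : ℝ) : ℂ) ^ (c - 1) * t) x := by
  have h1 : HasDerivAt (fun x : ℝ => ((b + t * x : ℝ) : ℂ)) (t : ℂ) x := by
    have : HasDerivAt (fun x : ℝ => b + t * x) t x := by
      simpa using ((hasDerivAt_id x).const_mul t).const_add b
    exact this.ofReal_comp
  exact (Complex.hasStrictDerivAt_cpow_const (c := c)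
    (Complex.ofReal_mem_slitPlane.2 h)).hasDerivAt.comp x h1

lemma gammaKernel_shift (A B : ℂ) (y : ℝ) {s : ℝ} (hs : 0 < s) :
    gammaKernel (A + 1) (B + 1) y s =
      (Real.exp (-s) : ℂ) * (s : ℂ) ^ (A - 1) * s * ((1 + y * s : ℝ) : ℂ) ^ (-B - 1) := by
  have hs' : (s : ℂ) ≠ 0 := by exact_mod_cast hs.ne'
  rw [gammaKernel, show A + 1 - 1 = (A - 1) + 1 by ring, Complex.cpow_add _ _ hs',
    Complex.cpow_one, show -(B + 1) = -B - 1 by ring]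
  ring

lemma hasDerivAt_gammaKernel (A B : ℂ) {y s : ℝ} (hy : 0 < y) (hs : 0 < s) :
    HasDerivAt (fun y => gammaKernel A B y s) (-B * gammaKernel (A + 1) (B + 1) y s) y := by
  have h : 0 < 1 + s * y := by positivity
  have h1 := (hasDerivAt_ofReal_cpow_affine (-B) h).const_mul
    ((Real.exp (-s) : ℂ) * (s : ℂ) ^ (A - 1))
  rw [gammaKernel_shift A B y hs]
  simp_rw [mul_comm s] at h1
  exact h1.congr_deriv (by ring)

lemma hasDerivAt_gammaAverage {A B : ℂ} (hA : 0 < A.re) (hB : 0 ≤ B.re) {y : ℝ} (hy : 0 < y) :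
    HasDerivAt (gammaAverage A B) (-B * gammaAverage (A + 1) (B + 1) y) y := by
  have hA' : 0 < (A + 1).re := by simp; linarith
  have hB' : 0 ≤ (B + 1).re := by simp; linarith
  have key := hasDerivAt_integral_of_dominated_loc_of_deriv_le
    (μ := volume.restrict (Set.Ioi (0 : ℝ))) (x₀ := y) (s := Set.Ioi 0)
    (F := fun y s => gammaKernel A B y s)
    (F' := fun y s => -B * gammaKernel (A + 1) (B + 1) y s)
    (bound := fun s => ‖B‖ * (Real.exp (-s) * s ^ ((A + 1).re - 1)))
    (Ioi_mem_nhds hy) (.of_forall fun y => (measurable_gammaKernel A B y).aestronglyMeasurable)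
    (integrable_gammaKernel hA hB hy.le)
    ((measurable_gammaKernel (A + 1) (B + 1) y).const_mul _).aestronglyMeasurable ?_
    ((integrable_gammaBound hA').const_mul _) ?_
  · rw [gammaAverage, ← integral_const_mul]
    exact key.2
  · filter_upwards [ae_restrict_mem measurableSet_Ioi] with s hs y hy
    rw [norm_mul, norm_neg]
    gcongr
    exact norm_gammaKernel_le _ hB' (le_of_lt hy) hs
  · filter_upwards [ae_restrict_mem measurableSet_Ioi] with s hs y hy
    exact hasDerivAt_gammaKernel A B hy hs

lemma continuousOn_gammaAverage {A B : ℂ} (hA : 0 < A.re) (hB : 0 ≤ B.re) :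
    ContinuousOn (gammaAverage A B) (Set.Ici 0) := by
  refine continuousOn_of_dominated (fun y _ => (measurable_gammaKernel A B y).aestronglyMeasurable)
    (bound := fun s => Real.exp (-s) * s ^ (A.re - 1)) ?_ (integrable_gammaBound hA) ?_
  · intro y hy
    filter_upwards [ae_restrict_mem measurableSet_Ioi] with s hs
    exact norm_gammaKernel_le _ hB hy hs
  · filter_upwards [ae_restrict_mem measurableSet_Ioi] with s hs y hy
    have hs : 0 < s := hs
    have hy : 0 ≤ y := hy
    have h : 0 < 1 + s * y := by positivity
    have h1 := (hasDerivAt_ofReal_cpow_affine (-B) h).continuousAt.continuousWithinAt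
      (s := Set.Ici 0)
    simp_rw [mul_comm s] at h1
    exact h1.const_mul ((Real.exp (-s) : ℂ) * (s : ℂ) ^ (A - 1))

lemma gammaAverage_zero {A : ℂ} (hA : 0 < A.re) (B : ℂ) :
    gammaAverage A B 0 = Complex.Gamma A := by
  rw [Complex.Gamma_eq_integral hA, Complex.GammaIntegral]
  simp [gammaAverage, gammaKernel]

/-- The equation `y² w'' + (1 + (1+A+B) y) w' + A B w = 0` for `w = gammaAverage A B`, with the
derivatives expressed through `hasDerivAt_gammaAverage`. The combination of integrands is a total
derivative in `s` whose boundary terms vanish. -/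
lemma gammaAverage_ode {A B : ℂ} (hA : 0 < A.re) (hB : 0 ≤ B.re) {y : ℝ} (hy : 0 < y) :
    (y : ℂ) ^ 2 * (B * (B + 1) * gammaAverage (A + 1 + 1) (B + 1 + 1) y)
      - (1 + (1 + A + B) * y) * (B * gammaAverage (A + 1) (B + 1) y)
      + A * B * gammaAverage A B y = 0 := by
  have hA1 : 0 < (A + 1).re := by simp; linarith
  have hB1 : 0 ≤ (B + 1).re := by simp; linarith
  have hA2 : 0 < (A + 1 + 1).re := by simp; linarith
  have hB2 : 0 ≤ (B + 1 + 1).re := by simp; linarith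
  have i0 := integrable_gammaKernel hA hB hy.le
  have i1 := integrable_gammaKernel hA1 hB1 hy.le
  have i2 := integrable_gammaKernel hA2 hB2 hy.le
  have j0 := i0.const_mul (A * B)
  have j1 := (i1.const_mul B).const_mul (1 + (1 + A + B) * y)
  have j2 := (i2.const_mul (B * (B + 1))).const_mul ((y : ℂ) ^ 2)
  -- the integrand is the derivative of `B * e ^ (-s) * s ^ A * (1 + y * s) ^ (-B - 1)`
  set P : ℝ → ℂ := fun s => B * gammaKernel (A + 1) (B + 1) y s with hP
  have hderiv : ∀ s ∈ Set.Ioi (0 : ℝ), HasDerivAt P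
      ((y : ℂ) ^ 2 * (B * (B + 1) * gammaKernel (A + 1 + 1) (B + 1 + 1) y s)
      - (1 + (1 + A + B) * y) * (B * gammaKernel (A + 1) (B + 1) y s)
      + A * B * gammaKernel A B y s) s := by
    intro s hs
    have hs : 0 < s := hs
    have hs' : (s : ℂ) ≠ 0 := by exact_mod_cast hs.ne'
    have hq : 0 < 1 + y * s := by positivity
    have hq' : ((1 + y * s : ℝ) : ℂ) ≠ 0 := by exact_mod_cast hq.ne'
    have e1 : HasDerivAt (fun s : ℝ => (Real.exp (-s) : ℂ)) (-(Real.exp (-s) : ℂ)) s := by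
      have := ((Real.hasDerivAt_exp (-s)).comp s (hasDerivAt_neg s)).ofReal_comp
      simpa using this
    have e2 : HasDerivAt (fun s : ℝ => (s : ℂ) ^ (A + 1 - 1)) (A * (s : ℂ) ^ (A - 1)) s := by
      have := hasDerivAt_ofReal_cpow_affine A (b := 0) (t := 1) (x := s) (by simpa using hs)
      simpa using this
    have e3 := hasDerivAt_ofReal_cpow_affine (-(B + 1)) hq
    refine (((e1.mul e2).mul e3).const_mul B).congr_deriv ?_
    simp only [Pi.mul_apply]
    rw [gammaKernel_shift (A + 1) (B + 1) y hs, gammaKernel_shift A B y hs, gammaKernel]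
    rw [show A + 1 - 1 = (A - 1) + 1 by ring, Complex.cpow_add _ _ hs', Complex.cpow_one,
      show -(B + 1) - 1 = -B - 1 - 1 by ring, show -(B + 1) = -B - 1 by ring,
      show (((1 + y * s : ℝ) : ℂ)) ^ (-B) = ((1 + y * s : ℝ) : ℂ) ^ (-B - 1 - 1) *
        ((1 + y * s : ℝ) : ℂ) * ((1 + y * s : ℝ) : ℂ) by
          conv_lhs => rw [show -B = -B - 1 - 1 + 1 + 1 by ring, Complex.cpow_add _ _ hq',
            Complex.cpow_add _ _ hq', Complex.cpow_one],
      show (((1 + y * s : ℝ) : ℂ)) ^ (-B - 1) = ((1 + y * s : ℝ) : ℂ) ^ (-B - 1 - 1) *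
        ((1 + y * s : ℝ) : ℂ) by
          conv_lhs => rw [show -B - 1 = -B - 1 - 1 + 1 by ring, Complex.cpow_add _ _ hq',
            Complex.cpow_one]]
    generalize ((1 + y * s : ℝ) : ℂ) ^ (-B - 1 - 1) = u
    generalize (s : ℂ) ^ (A - 1) = v
    push_cast
    ring
  have hint := (j2.sub j1).add j0
  have hbound : ∀ s : ℝ, 0 < s → ‖P s‖ ≤ ‖B‖ * (Real.exp (-s) * s ^ A.re) := by
    intro s hs
    rw [hP]
    simp only [norm_mul]
    gcongr
    simpa using norm_gammaKernel_le (A + 1) hB1 hy.le hs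
  have l0 : Tendsto P (𝓝[>] 0) (𝓝 0) := by
    refine squeeze_zero_norm' (a := fun s => ‖B‖ * (Real.exp (-s) * s ^ A.re)) ?_ ?_
    · filter_upwards [self_mem_nhdsWithin] with s hs using hbound s hs
    · have : ContinuousAt (fun s : ℝ => ‖B‖ * (Real.exp (-s) * s ^ A.re)) 0 := by
        have := Real.continuousAt_rpow_const 0 A.re (Or.inr hA.le)
        fun_prop
      simpa [Real.zero_rpow hA.ne'] using this.tendsto.mono_left nhdsWithin_le_nhds
  have l1 : Tendsto P atTop (𝓝 0) := by
    refine squeeze_zero_norm' (a := fun s => ‖B‖ * (Real.exp (-s) * s ^ A.re)) ?_ ?_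
    · filter_upwards [eventually_gt_atTop 0] with s hs using hbound s hs
    · have := (tendsto_rpow_mul_exp_neg_mul_atTop_nhds_zero A.re 1 one_pos).const_mul ‖B‖
      simpa [mul_comm] using this
  have hP0 : P 0 = 0 := by
    have : A ≠ 0 := by rintro rfl; simp at hA
    simp [hP, gammaKernel, this]
  have hcont : ContinuousWithinAt P (Set.Ici 0) 0 := by
    rw [← continuousWithinAt_Ioi_iff_Ici, ContinuousWithinAt, hP0]
    exact l0
  have key := integral_Ioi_of_hasDerivAt_of_tendsto hcont hderiv hint l1
  rw [hP0, sub_zero, integral_add (by exact j2.sub j1) j0, integral_sub j2 j1] at key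
  simp only [integral_const_mul] at key
  exact key

/-! ### An energy estimate -/

/-- Energy estimate for `y² d'' + (1 + (1+2a) y) d' + l d = g` on `(0, ∞)` with `|g| ≤ δ` and
`d(0+) = c`. The derivative of `l |d|² + y² |d'|²` is `2 Re (conj d' · g) - 2 (1 + 2ay) |d'|²`,
which is at most `δ² / 2`. -/
lemma energy_estimate {a l δ : ℝ} (ha : 0 ≤ a) {d d₁ d₂ g : ℝ → ℂ} {c : ℂ}
    (hd : ∀ y, 0 < y → HasDerivAt d (d₁ y) y) (hd₁ : ∀ y, 0 < y → HasDerivAt d₁ (d₂ y) y)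
    (hode : ∀ y : ℝ, 0 < y →
      (y : ℂ) ^ 2 * d₂ y + (1 + (1 + 2 * a) * y) * d₁ y + l * d y = g y)
    (hg : ∀ y, 0 < y → ‖g y‖ ≤ δ)
    (hd0 : Tendsto d (𝓝[>] 0) (𝓝 c)) (hd₁0 : Tendsto (fun y : ℝ => (y : ℂ) * d₁ y) (𝓝[>] 0) (𝓝 0))
    {y : ℝ} (hy : 0 < y) :
    l * ‖d y‖ ^ 2 + y ^ 2 * ‖d₁ y‖ ^ 2 ≤ l * ‖c‖ ^ 2 + δ ^ 2 / 2 * y := by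
  set E : ℝ → ℝ := fun y => l * ‖d y‖ ^ 2 + y ^ 2 * ‖d₁ y‖ ^ 2 - δ ^ 2 / 2 * y with hE
  have hE' : ∀ y, 0 < y → HasDerivAt E (l * (2 * inner ℝ (d y) (d₁ y)) +
      (2 * y * ‖d₁ y‖ ^ 2 + y ^ 2 * (2 * inner ℝ (d₁ y) (d₂ y))) - δ ^ 2 / 2) y := by
    intro y hy
    have h1 := (hd y hy).norm_sq.const_mul l
    have h2 := ((hasDerivAt_id y).pow 2).mul (hd₁ y hy).norm_sq
    have h3 := (hasDerivAt_id y).const_mul (δ ^ 2 / 2)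
    refine ((h1.add h2).sub h3).congr_deriv ?_
    simp
  have hneg : ∀ y, 0 < y → l * (2 * inner ℝ (d y) (d₁ y)) +
      (2 * y * ‖d₁ y‖ ^ 2 + y ^ 2 * (2 * inner ℝ (d₁ y) (d₂ y))) - δ ^ 2 / 2 ≤ 0 := by
    intro y hy
    have hkey : y ^ 2 * inner ℝ (d₁ y) (d₂ y) = inner ℝ (d₁ y) (g y)
        - (1 + (1 + 2 * a) * y) * ‖d₁ y‖ ^ 2 - l * inner ℝ (d y) (d₁ y) := by
      have := hode y hy
      rw [← this, ← Complex.normSq_eq_norm_sq]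
      simp only [Complex.inner, Complex.normSq_apply, ← Complex.ofReal_pow, Complex.mul_re,
        Complex.mul_im, Complex.conj_re, Complex.conj_im, Complex.add_re, Complex.add_im,
        Complex.ofReal_re, Complex.ofReal_im, Complex.one_re, Complex.one_im, Complex.re_ofNat,
        Complex.im_ofNat]
      ring
    have h1 : inner ℝ (d₁ y) (g y) ≤ ‖d₁ y‖ * δ :=
      (real_inner_le_norm _ _).trans (by gcongr; exact hg y hy)
    have h2 : 0 ≤ a * y * ‖d₁ y‖ ^ 2 := by positivity
    nlinarith [sq_nonneg (2 * ‖d₁ y‖ - δ)]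
  have hanti : AntitoneOn E (Set.Ioi 0) := by
    refine antitoneOn_of_deriv_nonpos (convex_Ioi 0)
      (fun y hy => (hE' y hy).continuousAt.continuousWithinAt) ?_ ?_
    · intro y hy
      rw [interior_Ioi] at hy
      exact (hE' y hy).differentiableAt.differentiableWithinAt
    · intro y hy
      rw [interior_Ioi] at hy
      rw [(hE' y hy).deriv]
      exact hneg y hy
  have hlim : Tendsto E (𝓝[>] 0) (𝓝 (l * ‖c‖ ^ 2)) := by
    have h1 := ((hd0.norm).pow 2).const_mul l
    have h2 := (hd₁0.norm).pow 2
    have h3 : Tendsto (fun y : ℝ => δ ^ 2 / 2 * y) (𝓝[>] 0) (𝓝 (δ ^ 2 / 2 * 0)) :=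
      (tendsto_id.mono_left nhdsWithin_le_nhds).const_mul _
    have h4 := (h1.add h2).sub h3
    simp only [norm_mul, mul_pow, Complex.norm_real, Real.norm_eq_abs, sq_abs, norm_zero] at h4
    simpa [hE] using h4
  have hle : E y ≤ l * ‖c‖ ^ 2 := by
    refine ge_of_tendsto hlim ?_
    filter_upwards [Ioo_mem_nhdsGT hy] with z hz
    exact hanti hz.1 hy hz.2.le
  simp only [hE] at hle
  linarith

/-! ### The normalized Whittaker function in the variable `y = 2x²` -/

/-- `𝑾_{α,ν}` as a function of `y = 2x²`, with `a = 1/2 - α`. -/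
noncomputable def profile (a : ℝ) (ν : ℂ) (y : ℝ) : ℂ :=
  (Complex.Gamma (a + ν))⁻¹ * gammaAverage (a + ν) (a - ν) y

/-- `ν` is a spectral parameter for `l`: a square root of `a² - l` in the strip `0 ≤ Re ν ≤ a`. -/
structure IsSpectral (a : ℝ) (ν : ℂ) (l : ℝ) : Prop where
  re_nonneg : 0 ≤ ν.re
  re_le : ν.re ≤ a
  sq_eq : ν ^ 2 = ((a ^ 2 - l : ℝ) : ℂ)

section

variable {a : ℝ} {ν : ℂ} {l : ℝ}

lemma IsSpectral.re_add_pos (h : IsSpectral a ν l) (ha : 0 < a) : 0 < ((a : ℂ) + ν).re := by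
  have := h.re_nonneg
  simp; linarith

lemma IsSpectral.re_sub_nonneg (h : IsSpectral a ν l) : 0 ≤ ((a : ℂ) - ν).re := by
  have := h.re_le
  simp; linarith

lemma IsSpectral.add_mul_sub (h : IsSpectral a ν l) : ((a : ℂ) + ν) * (a - ν) = l := by
  have := h.sq_eq
  push_cast at this
  linear_combination -this

lemma profile_zero (ha : 0 < a) (h : IsSpectral a ν l) : profile a ν 0 = 1 := by
  rw [profile, gammaAverage_zero (h.re_add_pos ha),
    inv_mul_cancel₀ (Complex.Gamma_ne_zero_of_re_pos (h.re_add_pos ha))]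

lemma continuousOn_profile (ha : 0 < a) (h : IsSpectral a ν l) :
    ContinuousOn (profile a ν) (Set.Ici 0) :=
  continuousOn_const.mul (continuousOn_gammaAverage (h.re_add_pos ha) h.re_sub_nonneg)

/-- The derivative of `profile a ν`. -/
noncomputable def profileDeriv (a : ℝ) (ν : ℂ) (y : ℝ) : ℂ :=
  (Complex.Gamma (a + ν))⁻¹ * (-(a - ν) * gammaAverage (a + ν + 1) (a - ν + 1) y)

/-- The second derivative of `profile a ν`. -/
noncomputable def profileDeriv₂ (a : ℝ) (ν : ℂ) (y : ℝ) : ℂ :=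
  (Complex.Gamma (a + ν))⁻¹ *
    (-(a - ν) * (-(a - ν + 1) * gammaAverage (a + ν + 1 + 1) (a - ν + 1 + 1) y))

lemma hasDerivAt_profile (ha : 0 < a) (h : IsSpectral a ν l) {y : ℝ} (hy : 0 < y) :
    HasDerivAt (profile a ν) (profileDeriv a ν y) y :=
  (hasDerivAt_gammaAverage (h.re_add_pos ha) h.re_sub_nonneg hy).const_mul _

lemma hasDerivAt_profileDeriv (ha : 0 < a) (h : IsSpectral a ν l) {y : ℝ} (hy : 0 < y) :
    HasDerivAt (profileDeriv a ν) (profileDeriv₂ a ν y) y := by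
  have h1 := h.re_add_pos ha
  have h2 := h.re_sub_nonneg
  refine ((hasDerivAt_gammaAverage ?_ ?_ hy).const_mul _).const_mul _
  · rw [Complex.add_re, Complex.one_re]; linarith
  · rw [Complex.add_re, Complex.one_re]; linarith

lemma profile_ode (ha : 0 < a) (h : IsSpectral a ν l) {y : ℝ} (hy : 0 < y) :
    (y : ℂ) ^ 2 * profileDeriv₂ a ν y + (1 + (1 + 2 * a) * y) * profileDeriv a ν y
      + l * profile a ν y = 0 := by
  have key := gammaAverage_ode (h.re_add_pos ha) h.re_sub_nonneg hy
  rw [h.add_mul_sub] at key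
  rw [profile, profileDeriv, profileDeriv₂]
  linear_combination (Complex.Gamma (a + ν))⁻¹ * key

lemma tendsto_profile (ha : 0 < a) (h : IsSpectral a ν l) :
    Tendsto (profile a ν) (𝓝[>] 0) (𝓝 1) := by
  rw [← profile_zero ha h]
  exact ((continuousOn_profile ha h) 0 Set.self_mem_Ici).mono_left
    (nhdsWithin_mono _ Set.Ioi_subset_Ici_self)

lemma tendsto_mul_profileDeriv (ha : 0 < a) (h : IsSpectral a ν l) :
    Tendsto (fun y : ℝ => (y : ℂ) * profileDeriv a ν y) (𝓝[>] 0) (𝓝 0) := by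
  have h1 := h.re_add_pos ha
  have h2 := h.re_sub_nonneg
  have h1' : 0 < ((a : ℂ) + ν + 1).re := by rw [Complex.add_re, Complex.one_re]; linarith
  have h2' : 0 ≤ ((a : ℂ) - ν + 1).re := by rw [Complex.add_re, Complex.one_re]; linarith
  have hc : ContinuousOn (fun y : ℝ => (y : ℂ) * profileDeriv a ν y) (Set.Ici 0) := by
    unfold profileDeriv
    exact Complex.continuous_ofReal.continuousOn.mul (continuousOn_const.mul
      (continuousOn_const.mul (continuousOn_gammaAverage h1' h2')))
  simpa using (hc 0 Set.self_mem_Ici).mono_left (nhdsWithin_mono _ Set.Ioi_subset_Ici_self)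

lemma IsSpectral.eq_of_zero (h : IsSpectral a ν 0) (ha : 0 < a) : ν = a := by
  have h0 := h.add_mul_sub
  rcases mul_eq_zero.1 (h0.trans Complex.ofReal_zero) with h3 | h3
  · have := h.re_add_pos ha
    rw [h3] at this
    simp at this
  · exact (sub_eq_zero.1 h3).symm

lemma profile_of_zero (ha : 0 < a) (h : IsSpectral a ν 0) (y : ℝ) : profile a ν y = 1 := by
  obtain rfl := h.eq_of_zero ha
  have : gammaAverage (a + a) (a - a) y = gammaAverage (a + a) (a - a) 0 := by
    simp [gammaAverage, gammaKernel]
  rw [profile, this, ← profile, profile_zero ha h]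

/-- The homogeneous energy estimate bounds `l |w|²` by `l`; for `l = 0` the solution is constant. -/
lemma norm_profile_le_one (ha : 0 < a) (h : IsSpectral a ν l) (hl : 0 ≤ l) {y : ℝ} (hy : 0 ≤ y) :
    ‖profile a ν y‖ ≤ 1 := by
  rcases hl.eq_or_lt with rfl | hl
  · rw [profile_of_zero ha h, norm_one]
  rcases hy.eq_or_lt with rfl | hy
  · rw [profile_zero ha h, norm_one]
  have key := energy_estimate (δ := 0) ha.le (fun y hy => hasDerivAt_profile ha h hy)
    (fun y hy => hasDerivAt_profileDeriv ha h hy) (fun y hy => profile_ode ha h hy)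
    (by simp) (tendsto_profile ha h) (tendsto_mul_profileDeriv ha h) hy
  have h2 : 0 ≤ y ^ 2 * ‖profileDeriv a ν y‖ ^ 2 := by positivity
  have h3 : l * ‖profile a ν y‖ ^ 2 ≤ l * 1 := by
    rw [norm_one] at key; linarith
  have h4 := le_of_mul_le_mul_left h3 hl
  exact (sq_le_one_iff₀ (norm_nonneg _)).1 h4

/-- The difference of two solutions solves the first equation with right-hand side
`(l' - l) * profile a ν'`, so the energy estimate bounds its derivative by `|l - l'| / √(2y)`,
which is integrable at `0`. -/
lemma norm_profile_sub_le {ν' : ℂ} {l' : ℝ} (ha : 0 < a) (h : IsSpectral a ν l)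
    (h' : IsSpectral a ν' l') (hl : 0 ≤ l) (hl' : 0 ≤ l') {x : ℝ} (hx : 0 ≤ x) :
    ‖profile a ν (2 * x ^ 2) - profile a ν' (2 * x ^ 2)‖ ≤ 2 * |l - l'| * x := by
  rcases hx.eq_or_lt with rfl | hx
  · simp [profile_zero ha h, profile_zero ha h']
  set d : ℝ → ℂ := fun y => profile a ν y - profile a ν' y with hd
  set d₁ : ℝ → ℂ := fun y => profileDeriv a ν y - profileDeriv a ν' y with hd₁
  have hdd : ∀ y, 0 < y → HasDerivAt d (d₁ y) y := fun y hy =>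
    (hasDerivAt_profile ha h hy).sub (hasDerivAt_profile ha h' hy)
  have hd0 : Tendsto d (𝓝[>] 0) (𝓝 0) := by
    simpa using (tendsto_profile ha h).sub (tendsto_profile ha h')
  have key : ∀ y, 0 < y → y ^ 2 * ‖d₁ y‖ ^ 2 ≤ |l - l'| ^ 2 / 2 * y := by
    intro y hy
    have e := energy_estimate (a := a) (l := l) (δ := |l - l'|) (d := d) (d₁ := d₁) (c := 0)
      (d₂ := fun y => profileDeriv₂ a ν y - profileDeriv₂ a ν' y)
      (g := fun y => (l' - l) * profile a ν' y) ha.le hdd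
      (fun y hy => (hasDerivAt_profileDeriv ha h hy).sub (hasDerivAt_profileDeriv ha h' hy))
      (fun y hy => by
        have e1 := profile_ode ha h hy
        have e2 := profile_ode ha h' hy
        simp only [hd, hd₁]
        linear_combination e1 - e2)
      (fun y hy => by
        have := norm_profile_le_one ha h' hl' hy.le
        rw [norm_mul, ← Complex.ofReal_sub, Complex.norm_real, Real.norm_eq_abs, abs_sub_comm]
        exact mul_le_of_le_one_right (abs_nonneg _) this)
      hd0
      (by simpa [hd₁, mul_sub] using
        (tendsto_mul_profileDeriv ha h).sub (tendsto_mul_profileDeriv ha h')) hy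
    have : 0 ≤ l * ‖d y‖ ^ 2 := by positivity
    simp only [norm_zero] at e
    linarith
  -- in the variable `x`, with `y = 2 * x ^ 2`, the energy bound is a Lipschitz bound
  have hder : ∀ t ∈ Set.Ioi (0 : ℝ), HasDerivWithinAt (fun t : ℝ => d (2 * t ^ 2))
      ((4 * t) • d₁ (2 * t ^ 2)) (Set.Ioi 0) t := by
    intro t ht
    have ht : 0 < t := ht
    have h1 : HasDerivAt (fun t : ℝ => 2 * t ^ 2) (4 * t) t := by
      refine ((hasDerivAt_pow 2 t).const_mul 2).congr_deriv ?_
      norm_num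
      ring
    exact ((hdd (2 * t ^ 2) (by positivity)).scomp t h1).hasDerivWithinAt
  have hb : ∀ t ∈ Set.Ioi (0 : ℝ), ‖(4 * t) • d₁ (2 * t ^ 2)‖ ≤ 2 * |l - l'| := by
    intro t ht
    have ht : 0 < t := ht
    have e := key (2 * t ^ 2) (by positivity)
    rw [norm_smul, Real.norm_of_nonneg (by positivity)]
    refine abs_le_of_sq_le_sq' ?_ (by positivity) |>.2
    have : 0 < t ^ 2 := by positivity
    have e' : t ^ 2 * (4 * t ^ 2 * ‖d₁ (2 * t ^ 2)‖ ^ 2) ≤ t ^ 2 * (|l - l'| ^ 2) := by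
      linarith
    have := le_of_mul_le_mul_left e' this
    linarith
  have hlip : ∀ ε ∈ Set.Ioo 0 x, ‖d (2 * x ^ 2) - d (2 * ε ^ 2)‖ ≤ 2 * |l - l'| * (x - ε) := by
    intro ε hε
    have := Convex.norm_image_sub_le_of_norm_hasDerivWithin_le hder hb (convex_Ioi 0)
      hε.1 hx
    rwa [Real.norm_of_nonneg (by linarith [hε.2])] at this
  have hsq : Tendsto (fun t : ℝ => 2 * t ^ 2) (𝓝[>] 0) (𝓝[>] 0) := by
    refine tendsto_nhdsWithin_iff.2 ⟨?_, ?_⟩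
    · have : ContinuousAt (fun t : ℝ => 2 * t ^ 2) 0 := by fun_prop
      simpa using this.tendsto.mono_left nhdsWithin_le_nhds
    · filter_upwards [self_mem_nhdsWithin] with t ht
      have ht : 0 < t := ht
      exact Set.mem_Ioi.2 (by positivity)
  have t1 : Tendsto (fun ε : ℝ => ‖d (2 * x ^ 2) - d (2 * ε ^ 2)‖) (𝓝[>] 0)
      (𝓝 ‖d (2 * x ^ 2) - 0‖) := (tendsto_const_nhds.sub (hd0.comp hsq)).norm
  have t2 : Tendsto (fun ε : ℝ => 2 * |l - l'| * (x - ε)) (𝓝[>] 0)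
      (𝓝 (2 * |l - l'| * (x - 0))) :=
    (tendsto_const_nhds.sub (tendsto_id.mono_left nhdsWithin_le_nhds)).const_mul _
  have := le_of_tendsto_of_tendsto t1 t2 (by
    filter_upwards [Ioo_mem_nhdsGT hx] with ε hε using hlip ε hε)
  simpa using this

lemma tendsto_profile_atTop (ha : 0 < a) (h : IsSpectral a ν l) (hν : ν.re < a) :
    Tendsto (profile a ν) atTop (𝓝 0) := by
  have h1 := h.re_add_pos ha
  have h2 := h.re_sub_nonneg
  rw [← mul_zero (Complex.Gamma (a + ν))⁻¹]
  refine Tendsto.const_mul _ ?_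
  rw [← integral_zero ℝ ℂ (μ := volume.restrict (Set.Ioi 0))]
  refine tendsto_integral_filter_of_dominated_convergence
    (bound := fun s => Real.exp (-s) * s ^ (((a : ℂ) + ν).re - 1))
    (.of_forall fun y => (measurable_gammaKernel _ _ y).aestronglyMeasurable) ?_
    (integrable_gammaBound h1) ?_
  · filter_upwards [eventually_ge_atTop 0] with y hy
    filter_upwards [ae_restrict_mem measurableSet_Ioi] with s hs
    exact norm_gammaKernel_le _ h2 hy hs
  · filter_upwards [ae_restrict_mem measurableSet_Ioi] with s hs
    have hs : 0 < s := hs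
    rw [tendsto_zero_iff_norm_tendsto_zero]
    have t1 : Tendsto (fun y : ℝ => 1 + y * s) atTop atTop :=
      tendsto_atTop_add_const_left _ _ (tendsto_id.atTop_mul_const hs)
    have t2 := ((tendsto_rpow_neg_atTop (y := ((a : ℂ) - ν).re) (by simpa using hν)).comp
      t1).const_mul (Real.exp (-s) * s ^ (((a : ℂ) + ν).re - 1))
    rw [mul_zero] at t2
    refine t2.congr' ?_
    filter_upwards [eventually_ge_atTop 0] with y hy
    rw [norm_gammaKernel _ _ hy hs]
    rfl

end

/-! ### Integral representation and bounds -/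

/-- The substitution `s = z t` in the integral defining the Tricomi function. -/
lemma tricomi_eq (A B : ℂ) {z : ℝ} (hz : 0 < z) :
    tricomi A (1 + A - B) z = (Complex.Gamma A)⁻¹ * ((z : ℂ) ^ (-A) * gammaAverage A B z⁻¹) := by
  have hz' : (z : ℂ) ≠ 0 := by exact_mod_cast hz.ne'
  have h := integral_comp_mul_left_Ioi (fun s => gammaKernel A B z⁻¹ s) 0 hz
  rw [mul_zero] at h
  have h2 : gammaAverage A B z⁻¹ = z * ∫ t in Set.Ioi (0 : ℝ), gammaKernel A B z⁻¹ (z * t) := by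
    rw [h, gammaAverage, Complex.real_smul, Complex.ofReal_inv, mul_inv_cancel_left₀ hz']
  rw [tricomi, h2]
  congr 1
  rw [← mul_assoc, ← integral_const_mul]
  refine setIntegral_congr_fun measurableSet_Ioi fun t ht => ?_
  have ht : 0 < t := ht
  simp only [gammaKernel]
  have e1 : (1 + z⁻¹ * (z * t) : ℝ) = 1 + t := by rw [inv_mul_cancel_left₀ hz.ne']
  rw [e1, Complex.ofReal_mul z t, Complex.mul_cpow_ofReal_nonneg hz.le ht.le,
    show 1 + A - B - A - 1 = -B by ring, ← Complex.ofReal_mul, Complex.ofReal_exp,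
    Complex.ofReal_neg]
  have e2 : (z : ℂ) ^ (-A) * z * (z : ℂ) ^ (A - 1) = 1 := by
    have hzA : (z : ℂ) ^ A ≠ 0 := by simp [Complex.cpow_eq_zero_iff, hz']
    rw [Complex.cpow_sub _ _ hz', Complex.cpow_one, Complex.cpow_neg]
    field_simp
  linear_combination (-Complex.exp (-((z * t : ℝ) : ℂ)) * (t : ℂ) ^ (A - 1) *
    ((1 + t : ℝ) : ℂ) ^ (-B)) * e2

lemma bW_eq_profile {α l : ℝ} {ν : ℂ} (hα : 0 < 1 / 2 - α) (h : IsSpectral (1 / 2 - α) ν l)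
    (x : ℝ≥0) : bW α ν x = profile (1 / 2 - α) ν (2 * (x : ℝ) ^ 2) := by
  rcases eq_or_ne x 0 with rfl | hx
  · simpa [bW] using (profile_zero hα h).symm
  have hx0 : 0 < (x : ℝ) := by positivity
  have hy : 0 < 2 * (x : ℝ) ^ 2 := by positivity
  set y : ℝ := 2 * (x : ℝ) ^ 2 with hyd
  have hz : 0 < 1 / y := by positivity
  have hz' : ((1 / y : ℝ) : ℂ) ≠ 0 := by exact_mod_cast hz.ne'
  have hA : (1 / 2 + ν - α : ℂ) = ((1 / 2 - α : ℝ) : ℂ) + ν := by push_cast; ring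
  have hC : (1 + 2 * ν : ℂ) = 1 + (((1 / 2 - α : ℝ) : ℂ) + ν) - (((1 / 2 - α : ℝ) : ℂ) - ν) := by
    ring
  rw [bW, if_neg hx, whittakerW, if_pos h.re_nonneg, whittakerAux, hA, hC, tricomi_eq _ _ hz,
    profile]
  have e1 : (2 : ℝ) ^ α * (x : ℝ) ^ (2 * α) * Real.exp (1 / (4 * (x : ℝ) ^ 2)) =
      (1 / y) ^ (-α) * Real.exp (1 / y / 2) := by
    congr 1
    · rw [Real.rpow_mul hx0.le, ← Real.mul_rpow (by norm_num) (by positivity), Real.rpow_two,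
        one_div, Real.inv_rpow hy.le, Real.rpow_neg hy.le, inv_inv]
    · congr 1
      rw [hyd]
      field_simp
      norm_num
  have e2 : ((1 / y : ℝ) : ℂ) ^ (1 / 2 + ν) * ((1 / y : ℝ) : ℂ) ^ (-(((1 / 2 - α : ℝ) : ℂ) + ν)) =
      ((1 / y : ℝ) : ℂ) ^ (α : ℂ) := by
    rw [← Complex.cpow_add _ _ hz']
    congr 1
    push_cast
    ring
  have e3 : ((1 / y : ℝ) : ℂ) ^ (-(α : ℂ)) * ((1 / y : ℝ) : ℂ) ^ (α : ℂ) = 1 := by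
    rw [← Complex.cpow_add _ _ hz']; simp
  have e4 : Complex.exp ((1 / y / 2 : ℝ) : ℂ) * Complex.exp (-((1 / y / 2 : ℝ) : ℂ)) = 1 := by
    rw [← Complex.exp_add]; simp
  rw [e1, Complex.ofReal_mul, Complex.ofReal_cpow hz.le, Complex.ofReal_neg, Complex.ofReal_exp,
    show (1 / y)⁻¹ = y by simp]
  generalize gammaAverage _ _ _ = G
  generalize (Complex.Gamma _)⁻¹ = H
  calc _ = (((1 / y : ℝ) : ℂ) ^ (-(α : ℂ)) *
        (((1 / y : ℝ) : ℂ) ^ (1 / 2 + ν) * ((1 / y : ℝ) : ℂ) ^ (-(((1 / 2 - α : ℝ) : ℂ) + ν)))) *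
        (Complex.exp ((1 / y / 2 : ℝ) : ℂ) * Complex.exp (-((1 / y / 2 : ℝ) : ℂ))) * (H * G) := by
        ring
    _ = H * G := by rw [e2, e3, e4]; ring

lemma isSpectral_Δ {α : ℝ} (hα : 0 < 1 / 2 - α) (l : ℝ≥0) :
    IsSpectral (1 / 2 - α) (Δ α l) l where
  re_nonneg := by rw [Δ, Complex.re_sqrt_ofReal]; positivity
  re_le := by
    rw [Δ, Complex.re_sqrt_ofReal]
    exact Real.sqrt_le_iff.2 ⟨hα.le, by linarith [l.coe_nonneg]⟩
  sq_eq := by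
    rw [Δ, Complex.sqrt]
    exact_mod_cast Complex.cpow_nat_inv_pow _ two_ne_zero

section
variable {α : ℝ}

lemma continuous_bW (hα : 0 < 1 / 2 - α) (l : ℝ≥0) : Continuous (bW α (Δ α l)) := by
  rw [show bW α (Δ α l) = fun x : ℝ≥0 => profile (1 / 2 - α) (Δ α l) (2 * (x : ℝ) ^ 2) from
    funext (bW_eq_profile hα (isSpectral_Δ hα l))]
  exact (continuousOn_profile hα (isSpectral_Δ hα l)).comp_continuous (by fun_prop)
    fun x => Set.mem_Ici.2 (by positivity)

lemma norm_bW_le_one (hα : 0 < 1 / 2 - α) (l x : ℝ≥0) : ‖bW α (Δ α l) x‖ ≤ 1 := by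
  rw [bW_eq_profile hα (isSpectral_Δ hα l)]
  exact norm_profile_le_one hα (isSpectral_Δ hα l) l.coe_nonneg (by positivity)

/-- `𝑾_{α,Δ_l}` as a bounded continuous function. -/
noncomputable def bWBounded (hα : 0 < 1 / 2 - α) (l : ℝ≥0) : BoundedContinuousFunction ℝ≥0 ℂ :=
  .ofNormedAddCommGroup (bW α (Δ α l)) (continuous_bW hα l) 1 (norm_bW_le_one hα l)

lemma integrable_bW (hα : 0 < 1 / 2 - α) (μ : FiniteMeasure ℝ≥0) (l : ℝ≥0) :
    Integrable (bW α (Δ α l)) (μ : Measure ℝ≥0) :=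
  (bWBounded hα l).integrable (μ : Measure ℝ≥0)

lemma tendsto_transform (hα : 0 < 1 / 2 - α) {ι : Type*} {F : Filter ι}
    {μs : ι → FiniteMeasure ℝ≥0} {μ : FiniteMeasure ℝ≥0} (h : Tendsto μs F (𝓝 μ)) (l : ℝ≥0) :
    Tendsto (fun i => transform α (μs i : Measure ℝ≥0) l) F
      (𝓝 (transform α (μ : Measure ℝ≥0) l)) :=
  (FiniteMeasure.tendsto_iff_forall_integral_rclike_tendsto ℂ).1 h (bWBounded hα l)

lemma norm_bW_sub_le (hα : 0 < 1 / 2 - α) (l l' x : ℝ≥0) :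
    ‖bW α (Δ α l) x - bW α (Δ α l') x‖ ≤ min 2 (2 * dist l l' * x) := by
  refine le_min ?_ ?_
  · linarith [norm_sub_le (bW α (Δ α l) x) (bW α (Δ α l') x), norm_bW_le_one hα l x,
      norm_bW_le_one hα l' x]
  · rw [bW_eq_profile hα (isSpectral_Δ hα l), bW_eq_profile hα (isSpectral_Δ hα l')]
    exact norm_profile_sub_le hα (isSpectral_Δ hα l) (isSpectral_Δ hα l') l.coe_nonneg
      l'.coe_nonneg x.coe_nonneg

end

/-! ### Moduli of continuity of the transform -/

/-- The bounded continuous function `x ↦ min 2 (2ρx)`, which bounds the variation of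
`l ↦ 𝑾_{α,Δ_l}(x)` over intervals of length `ρ`. -/
noncomputable def modulusFun (ρ : ℝ≥0) : BoundedContinuousFunction ℝ≥0 ℝ :=
  .ofNormedAddCommGroup (fun x : ℝ≥0 => min 2 (2 * (ρ : ℝ) * x)) (by fun_prop) 2 fun x => by
    rw [Real.norm_of_nonneg (le_min (by norm_num) (by positivity))]
    exact min_le_left _ _

/-- `∫ min 2 (2ρx) μ(dx)`, a modulus of continuity of the transform of `μ`. -/
noncomputable def modulus (μ : Measure ℝ≥0) (ρ : ℝ≥0) : ℝ :=
  ∫ x, modulusFun ρ x ∂μ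

lemma norm_transform_sub_le {α : ℝ} (hα : 0 < 1 / 2 - α) (μ : FiniteMeasure ℝ≥0) {l l' ρ : ℝ≥0}
    (h : dist l l' ≤ ρ) :
    ‖transform α (μ : Measure ℝ≥0) l - transform α (μ : Measure ℝ≥0) l'‖ ≤
      modulus (μ : Measure ℝ≥0) ρ := by
  rw [transform, transform, ← integral_sub (integrable_bW hα μ l) (integrable_bW hα μ l')]
  refine norm_integral_le_of_norm_le ((modulusFun ρ).integrable _) (.of_forall fun x => ?_)
  refine (norm_bW_sub_le hα l l' x).trans (min_le_min_left _ ?_)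
  gcongr

lemma tendsto_modulus (μ : Measure ℝ≥0) [IsFiniteMeasure μ] :
    Tendsto (modulus μ) (𝓝 0) (𝓝 0) := by
  rw [← integral_zero ℝ≥0 ℝ (μ := μ)]
  refine tendsto_integral_filter_of_dominated_convergence (bound := fun _ => 2)
    (.of_forall fun ρ => (modulusFun ρ).continuous.aestronglyMeasurable) ?_
    (integrable_const _) ?_
  · refine .of_forall fun ρ => .of_forall fun x => ?_
    change ‖min 2 (2 * (ρ : ℝ) * x)‖ ≤ 2
    rw [Real.norm_of_nonneg (le_min (by norm_num) (by positivity))]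
    exact min_le_left _ _
  · refine .of_forall fun x => ?_
    have : Continuous fun ρ : ℝ≥0 => min 2 (2 * (ρ : ℝ) * x) := by fun_prop
    have h0 := this.tendsto 0
    simp only [NNReal.coe_zero, mul_zero, zero_mul, zero_le_two, min_eq_right] at h0
    exact h0

lemma exists_modulus_lt (μ : Measure ℝ≥0) [IsFiniteMeasure μ] {ε : ℝ} (hε : 0 < ε) :
    ∃ ρ : ℝ≥0, 0 < ρ ∧ modulus μ ρ < ε := by
  have h := ((tendsto_modulus μ).mono_left
    (nhdsWithin_le_nhds (s := Set.Ioi 0))).eventually (gt_mem_nhds hε)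
  obtain ⟨ρ, h1, h2⟩ := (h.and (self_mem_nhdsWithin (s := Set.Ioi (0 : ℝ≥0)))).exists
  exact ⟨ρ, h2, h1⟩

lemma uniformEquicontinuous_transform {α : ℝ} (hα : 0 < 1 / 2 - α) {J : Type*}
    (μ : J → FiniteMeasure ℝ≥0)
    (h : ∀ ε : ℝ, 0 < ε → ∃ ρ : ℝ≥0, 0 < ρ ∧ ∀ j, modulus (μ j : Measure ℝ≥0) ρ < ε) :
    UniformEquicontinuous fun j => transform α (μ j : Measure ℝ≥0) := by
  rw [Metric.uniformEquicontinuous_iff]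
  intro ε hε
  obtain ⟨ρ, hρ, hj⟩ := h ε hε
  refine ⟨ρ, hρ, fun l l' hl j => ?_⟩
  rw [dist_eq_norm]
  exact (norm_transform_sub_le hα (μ j) hl.le).trans_lt (hj j)

lemma uniformContinuous_transform {α : ℝ} (hα : 0 < 1 / 2 - α) (μ : FiniteMeasure ℝ≥0) :
    UniformContinuous (transform α (μ : Measure ℝ≥0)) :=
  (uniformEquicontinuous_transform hα (fun _ : Unit => μ) fun _ hε =>
    let ⟨ρ, h1, h2⟩ := exists_modulus_lt (μ : Measure ℝ≥0) hε
    ⟨ρ, h1, fun _ => h2⟩).uniformContinuous ()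

/-- The point `0` contributes nothing to the modulus, so tightness is only needed on `(0, ∞)`. -/
lemma exists_modulus_lt_of_isTightMeasureSet {J : Type*} (μ : J → ProbabilityMeasure ℝ≥0)
    (h : IsTightMeasureSet
      (Set.range fun j => (μ j : Measure ℝ≥0).restrict (Set.Ioi (0 : ℝ≥0))))
    {ε : ℝ} (hε : 0 < ε) :
    ∃ ρ : ℝ≥0, 0 < ρ ∧ ∀ j, modulus (μ j : Measure ℝ≥0) ρ < ε := by
  rw [isTightMeasureSet_iff_exists_isCompact_measure_compl_le] at h
  obtain ⟨K, hK, hμ⟩ := h (ENNReal.ofReal (ε / 8)) (by simpa using hε)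
  obtain ⟨R, hR⟩ := hK.bddAbove
  obtain ⟨ρ, hρ⟩ : ∃ ρ : ℝ≥0, (ρ : ℝ) = ε / (8 * (R + 1)) :=
    ⟨Real.toNNReal _, Real.coe_toNNReal _ (by positivity)⟩
  refine ⟨ρ, ?_, fun j => ?_⟩
  · rw [← NNReal.coe_pos, hρ]
    positivity
  have hms : MeasurableSet Kᶜ := hK.measurableSet.compl
  have hT : MeasurableSet (Kᶜ ∩ Set.Ioi 0) := hms.inter measurableSet_Ioi
  have hm := hμ _ ⟨j, rfl⟩
  rw [Measure.restrict_apply hms] at hm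
  have hm' : (μ j : Measure ℝ≥0).real (Kᶜ ∩ Set.Ioi 0) ≤ ε / 8 :=
    ENNReal.toReal_le_of_le_ofReal (by positivity) hm
  have hρR : 2 * (ρ : ℝ) * R ≤ ε / 4 := by
    rw [hρ]
    have hR0 : (0 : ℝ) ≤ R := R.coe_nonneg
    rw [show 2 * (ε / (8 * ((R : ℝ) + 1))) * R = ε / 4 * (R / (R + 1)) by
      field_simp; ring]
    refine mul_le_of_le_one_right (by positivity) ?_
    rw [div_le_one (by positivity)]
    linarith
  have hle : modulus (μ j : Measure ℝ≥0) ρ ≤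
      ∫ x, ((Kᶜ ∩ Set.Ioi 0).indicator (fun _ => (2 : ℝ)) x + ε / 4) ∂(μ j : Measure ℝ≥0) := by
    refine integral_mono ((modulusFun ρ).integrable _)
      (((integrable_const _).indicator hT).add (integrable_const _)) fun x => ?_
    change min 2 (2 * (ρ : ℝ) * x) ≤ _
    by_cases hx : x ∈ Kᶜ ∩ Set.Ioi 0
    · rw [Set.indicator_of_mem hx]
      exact (min_le_left _ _).trans (by linarith)
    · rw [Set.indicator_of_notMem hx, zero_add]
      refine (min_le_right _ _).trans (le_trans ?_ hρR)
      gcongr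
      by_cases hxK : x ∈ K
      · exact hR hxK
      · have : x = 0 := by
          by_contra h0
          exact hx ⟨hxK, pos_iff_ne_zero.2 h0⟩
        simp [this]
  refine hle.trans_lt ?_
  rw [integral_add ((integrable_const _).indicator hT) (integrable_const _),
    integral_indicator_const _ hT]
  simp only [smul_eq_mul, integral_const, probReal_univ, one_mul]
  linarith

lemma tendstoUniformlyOn_transform {α : ℝ} (hα : 0 < 1 / 2 - α)
    {μs : ℕ → FiniteMeasure ℝ≥0} {μ : FiniteMeasure ℝ≥0} (h : Tendsto μs atTop (𝓝 μ))
    {K : Set ℝ≥0} (hK : IsCompact K) :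
    TendstoUniformlyOn (fun n => transform α (μs n : Measure ℝ≥0))
      (transform α (μ : Measure ℝ≥0)) atTop K := by
  rw [Metric.tendstoUniformlyOn_iff]
  intro ε hε
  obtain ⟨ρ, hρ, hρ'⟩ := exists_modulus_lt (μ : Measure ℝ≥0) (show 0 < ε / 3 by positivity)
  have h1 : ∀ᶠ n in atTop, modulus (μs n : Measure ℝ≥0) ρ < ε / 3 :=
    (FiniteMeasure.tendsto_iff_forall_integral_tendsto.1 h (modulusFun ρ)).eventually
      (gt_mem_nhds hρ')
  obtain ⟨t, -, ht, hKt⟩ := hK.finite_cover_balls (e := (ρ : ℝ)) (by exact_mod_cast hρ)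
  have h2 : ∀ᶠ n in atTop, ∀ c ∈ t,
      dist (transform α (μs n : Measure ℝ≥0) c) (transform α (μ : Measure ℝ≥0) c) < ε / 3 :=
    (ht.eventually_all).2 fun c _ =>
      (tendsto_transform hα h c).eventually (Metric.ball_mem_nhds _ (by positivity))
  filter_upwards [h1, h2] with n hn1 hn2 l hl
  obtain ⟨c, hc, hlc⟩ := Set.mem_iUnion₂.1 (hKt hl)
  have hlc : dist l c < ρ := hlc
  have d1 := norm_transform_sub_le hα μ hlc.le
  have d2 := norm_transform_sub_le hα (μs n) hlc.le
  have d3 := hn2 c hc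
  rw [← dist_eq_norm] at d1 d2
  have := dist_triangle4 (transform α (μ : Measure ℝ≥0) l) (transform α (μ : Measure ℝ≥0) c)
    (transform α (μs n : Measure ℝ≥0) c) (transform α (μs n : Measure ℝ≥0) l)
  rw [dist_comm] at d2 d3
  linarith

/-! ### Uniqueness of Laplace transforms -/

/-- The functions `x ↦ e^{-k g(x)}`, multiplicative in `k ≥ 0`. -/
noncomputable def expNegHom {E : Type*} [TopologicalSpace E] {g : E → ℝ} (hg : Continuous g)
    (hg0 : ∀ x, 0 ≤ g x) : Multiplicative ℝ≥0 →* BoundedContinuousFunction E ℝ where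
  toFun k := .ofNormedAddCommGroup (fun x => Real.exp (-((k.toAdd : ℝ) * g x))) (by fun_prop) 1
    fun x => by
      rw [Real.norm_of_nonneg (Real.exp_pos _).le, Real.exp_le_one_iff]
      have := mul_nonneg k.toAdd.coe_nonneg (hg0 x)
      linarith
  map_one' := by ext x; simp
  map_mul' k k' := by
    ext x
    simp [← Real.exp_add, add_mul, add_comm]

/-- Finite measures on a Polish space are determined by their Laplace transform along a continuous
injective nonnegative function: the span of the exponentials is a point-separating algebra. -/
lemma ext_of_integral_exp_neg_mul_eq {E : Type*} [TopologicalSpace E] [PolishSpace E]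
    [MeasurableSpace E] [BorelSpace E] {P P' : Measure E} [IsFiniteMeasure P] [IsFiniteMeasure P']
    {g : E → ℝ} (hg : Continuous g) (hg0 : ∀ x, 0 ≤ g x) (hinj : Function.Injective g)
    (h : ∀ k : ℝ≥0, ∫ x, Real.exp (-((k : ℝ) * g x)) ∂P = ∫ x, Real.exp (-((k : ℝ) * g x)) ∂P') :
    P = P' := by
  set A₀ : Subalgebra ℝ (BoundedContinuousFunction E ℝ) :=
    Algebra.adjoin ℝ (MonoidHom.mrange (expNegHom hg hg0) : Set (BoundedContinuousFunction E ℝ))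
    with hA₀
  let A : StarSubalgebra ℝ (BoundedContinuousFunction E ℝ) :=
    { A₀ with
      star_mem' := fun {f} hf => by
        have : star f = f := by ext x; simp
        rw [this]; exact hf }
  refine ext_of_forall_mem_subalgebra_integral_eq_of_polish (𝕜 := ℝ) (A := A) ?_ ?_
  · intro x y hxy
    refine ⟨fun z => Real.exp (-((1 : ℝ≥0) * g z)), ?_, ?_⟩
    · refine ⟨(expNegHom hg hg0 (Multiplicative.ofAdd 1)).toContinuousMap,
        ⟨expNegHom hg hg0 (Multiplicative.ofAdd 1),
          Algebra.subset_adjoin ⟨Multiplicative.ofAdd 1, rfl⟩, rfl⟩, rfl⟩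
    · intro hE
      have := Real.exp_injective hE
      exact hxy (hinj (by simpa using this))
  · intro f hf
    have hf' : f ∈ Submodule.span ℝ
        (MonoidHom.mrange (expNegHom hg hg0) : Set (BoundedContinuousFunction E ℝ)) := by
      have hf : f ∈ Subalgebra.toSubmodule A₀ := hf
      rwa [hA₀, Algebra.adjoin_eq_span, Submonoid.closure_eq] at hf
    clear hf
    induction hf' using Submodule.span_induction with
    | mem f hf =>
      obtain ⟨k, rfl⟩ := hf
      exact h k.toAdd
    | zero => simp
    | add f f' _ _ ih ih' =>
      simp only [BoundedContinuousFunction.coe_add, Pi.add_apply]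
      rw [integral_add (f.integrable _) (f'.integrable _),
        integral_add (f.integrable _) (f'.integrable _), ih, ih']
    | smul c f _ ih =>
      simp only [BoundedContinuousFunction.coe_smul, integral_smul, ih]

/-- Finite measures on `ℝ` carried by `[0, ∞)` are determined by their Laplace transform. -/
lemma ext_of_integral_exp_neg_mul_eq_of_ae_nonneg {P P' : Measure ℝ} [IsFiniteMeasure P]
    [IsFiniteMeasure P'] (hP : ∀ᵐ x ∂P, 0 ≤ x) (hP' : ∀ᵐ x ∂P', 0 ≤ x)
    (h : ∀ k : ℝ≥0, ∫ x, Real.exp (-((k : ℝ) * x)) ∂P = ∫ x, Real.exp (-((k : ℝ) * x)) ∂P') :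
    P = P' := by
  have hmap : ∀ Q : Measure ℝ, (∀ᵐ x ∂Q, 0 ≤ x) →
      (Q.map Real.toNNReal).map ((↑) : ℝ≥0 → ℝ) = Q := by
    intro Q hQ
    rw [Measure.map_map (by fun_prop) (by fun_prop)]
    conv_rhs => rw [← Measure.map_id (μ := Q)]
    refine Measure.map_congr ?_
    filter_upwards [hQ] with x hx
    exact Real.coe_toNNReal x hx
  have hint : ∀ Q : Measure ℝ, (∀ᵐ x ∂Q, 0 ≤ x) → ∀ k : ℝ≥0,
      ∫ x : ℝ≥0, Real.exp (-((k : ℝ) * x)) ∂(Q.map Real.toNNReal) =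
        ∫ x, Real.exp (-((k : ℝ) * x)) ∂Q := by
    intro Q hQ k
    rw [integral_map (by fun_prop)
      (by fun_prop : Continuous fun x : ℝ≥0 => Real.exp (-((k : ℝ) * x))).aestronglyMeasurable]
    refine integral_congr_ae ?_
    filter_upwards [hQ] with x hx
    rw [Real.coe_toNNReal x hx]
  rw [← hmap P hP, ← hmap P' hP']
  congr 1
  refine ext_of_integral_exp_neg_mul_eq NNReal.continuous_coe (fun x => x.coe_nonneg)
    NNReal.coe_injective fun k => ?_
  rw [hint P hP, hint P' hP', h]

/-! ### The transform on imaginary spectral parameters as a characteristic function -/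

/-- The density `e^{-s} s^{a-1} (1+2x²s)^{-a}` at `p = (x, s)`. -/
noncomputable def logDensity (a : ℝ) (p : ℝ≥0 × ℝ) : ℝ :=
  Real.exp (-p.2) * p.2 ^ (a - 1) * (1 + 2 * (p.1 : ℝ) ^ 2 * p.2) ^ (-a)

/-- `log (s (1+2x²s))` at `p = (x, s)`. -/
noncomputable def logMap (p : ℝ≥0 × ℝ) : ℝ :=
  Real.log (p.2 * (1 + 2 * (p.1 : ℝ) ^ 2 * p.2))

/-- The product of `μ` and Lebesgue measure on `(0, ∞)`. -/
noncomputable def baseMeasure (μ : Measure ℝ≥0) : Measure (ℝ≥0 × ℝ) :=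
  μ.prod (volume.restrict (Set.Ioi 0))

/-- The image under `(x, s) ↦ log (s (1+2x²s))` of `e^{-s} s^{a-1} (1+2x²s)^{-a} ds μ(dx)`. -/
noncomputable def logMeasure (a : ℝ) (μ : Measure ℝ≥0) : Measure ℝ :=
  ((baseMeasure μ).withDensity fun p => ENNReal.ofReal (logDensity a p)).map logMap

@[fun_prop]
lemma measurable_logDensity (a : ℝ) : Measurable (logDensity a) := by
  unfold logDensity; fun_prop

@[fun_prop]
lemma measurable_logMap : Measurable logMap := by
  unfold logMap; fun_prop

lemma ae_baseMeasure_pos (μ : Measure ℝ≥0) [SFinite μ] : ∀ᵐ p ∂baseMeasure μ, 0 < p.2 :=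
  Measure.quasiMeasurePreserving_snd.ae (ae_restrict_mem measurableSet_Ioi)

lemma integrable_baseMeasure_of_le {μ : Measure ℝ≥0} [IsFiniteMeasure μ] {E : Type*}
    [NormedAddCommGroup E] {F : ℝ≥0 × ℝ → E} {q : ℝ} (hq : 0 < q)
    (hF : AEStronglyMeasurable F (baseMeasure μ))
    (h : ∀ p : ℝ≥0 × ℝ, 0 < p.2 → ‖F p‖ ≤ Real.exp (-p.2) * p.2 ^ (q - 1)) :
    Integrable F (baseMeasure μ) := by
  have hb : Integrable (fun p : ℝ≥0 × ℝ => (1 : ℝ) * (Real.exp (-p.2) * p.2 ^ (q - 1)))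
      (baseMeasure μ) :=
    Integrable.mul_prod (f := fun _ : ℝ≥0 => (1 : ℝ)) (integrable_const _)
      (integrable_gammaBound hq)
  refine hb.mono' hF ?_
  filter_upwards [ae_baseMeasure_pos μ] with p hp
  rw [one_mul]
  exact h p hp

lemma logDensity_nonneg (a : ℝ) {p : ℝ≥0 × ℝ} (hp : 0 < p.2) : 0 ≤ logDensity a p := by
  unfold logDensity; positivity

lemma logDensity_le {a : ℝ} (ha : 0 < a) {p : ℝ≥0 × ℝ} (hp : 0 < p.2) :
    logDensity a p ≤ Real.exp (-p.2) * p.2 ^ (a - 1) := by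
  refine mul_le_of_le_one_right (by positivity) ?_
  refine Real.rpow_le_one_of_one_le_of_nonpos ?_ (by linarith)
  have : 0 ≤ 2 * (p.1 : ℝ) ^ 2 * p.2 := by positivity
  linarith

lemma isFiniteMeasure_logMeasure {a : ℝ} (ha : 0 < a) (μ : Measure ℝ≥0) [IsFiniteMeasure μ] :
    IsFiniteMeasure (logMeasure a μ) := by
  have hint : Integrable (logDensity a) (baseMeasure μ) :=
    integrable_baseMeasure_of_le ha (measurable_logDensity a).aestronglyMeasurable fun p hp => by
      rw [Real.norm_of_nonneg (logDensity_nonneg a hp)]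
      exact logDensity_le ha hp
  have := isFiniteMeasure_withDensity_ofReal hint.2
  exact Measure.isFiniteMeasure_map _ _

lemma integral_logMeasure {a : ℝ} {μ : Measure ℝ≥0} [SFinite μ] {E : Type*}
    [NormedAddCommGroup E] [NormedSpace ℝ E] {g : ℝ → E} (hg : StronglyMeasurable g) :
    ∫ t, g t ∂logMeasure a μ = ∫ p, logDensity a p • g (logMap p) ∂baseMeasure μ := by
  rw [logMeasure, integral_map measurable_logMap.aemeasurable hg.aestronglyMeasurable,
    integral_withDensity_eq_integral_toReal_smul (by fun_prop) (by simp)]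
  refine integral_congr_ae ?_
  filter_upwards [ae_baseMeasure_pos μ] with p hp
  rw [ENNReal.toReal_ofReal (logDensity_nonneg a hp)]

lemma logDensity_mul_exp (a τ : ℝ) {p : ℝ≥0 × ℝ} (hp : 0 < p.2) :
    logDensity a p • Complex.exp (τ * logMap p * Complex.I) =
      gammaKernel (a + τ * Complex.I) (a - τ * Complex.I) (2 * (p.1 : ℝ) ^ 2) p.2 := by
  obtain ⟨x, s⟩ := p
  have hs : 0 < s := hp
  have hq : 0 < 1 + 2 * (x : ℝ) ^ 2 * s := by positivity
  have hs' : (s : ℂ) ≠ 0 := by exact_mod_cast hs.ne'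
  have hq' : ((1 + 2 * (x : ℝ) ^ 2 * s : ℝ) : ℂ) ≠ 0 := by exact_mod_cast hq.ne'
  have e : Complex.exp (τ * logMap (x, s) * Complex.I) =
      (s : ℂ) ^ (τ * Complex.I) * ((1 + 2 * (x : ℝ) ^ 2 * s : ℝ) : ℂ) ^ (τ * Complex.I) := by
    rw [Complex.cpow_def_of_ne_zero hs', Complex.cpow_def_of_ne_zero hq', ← Complex.exp_add,
      ← Complex.ofReal_log hs.le, ← Complex.ofReal_log hq.le, logMap,
      Real.log_mul hs.ne' hq.ne', Complex.ofReal_add]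
    congr 1
    ring
  rw [e, logDensity, gammaKernel, Complex.real_smul, Complex.ofReal_mul, Complex.ofReal_mul,
    Complex.ofReal_cpow hs.le, Complex.ofReal_cpow hq.le,
    show (a : ℂ) + τ * Complex.I - 1 = ((a - 1 : ℝ) : ℂ) + τ * Complex.I by push_cast; ring,
    show -((a : ℂ) - τ * Complex.I) = ((-a : ℝ) : ℂ) + τ * Complex.I by push_cast; ring,
    Complex.cpow_add _ _ hs', Complex.cpow_add _ _ hq']
  ring

lemma charFun_logMeasure {a : ℝ} (ha : 0 < a) (μ : Measure ℝ≥0) [IsFiniteMeasure μ] (τ : ℝ) :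
    charFun (logMeasure a μ) τ =
      ∫ x : ℝ≥0, gammaAverage (a + τ * Complex.I) (a - τ * Complex.I) (2 * (x : ℝ) ^ 2) ∂μ := by
  have hF : AEStronglyMeasurable
      (fun p => logDensity a p • Complex.exp (τ * logMap p * Complex.I)) (baseMeasure μ) := by
    refine Measurable.aestronglyMeasurable ?_
    fun_prop
  have hint := integrable_baseMeasure_of_le ha hF fun p hp => by
    rw [norm_smul, show (τ : ℂ) * logMap p * Complex.I = ((τ * logMap p : ℝ) : ℂ) * Complex.I by
      push_cast; ring, Complex.norm_exp_ofReal_mul_I, mul_one,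
      Real.norm_of_nonneg (logDensity_nonneg a hp)]
    exact logDensity_le ha hp
  rw [charFun_apply_real, integral_logMeasure (by fun_prop), baseMeasure, integral_prod _ hint]
  refine integral_congr_ae (.of_forall fun x => ?_)
  exact setIntegral_congr_fun measurableSet_Ioi fun s hs => logDensity_mul_exp a τ (p := (x, s)) hs

/-- Above the threshold `a²` the spectral parameter is purely imaginary and takes every value `iτ`,
`τ ≥ 0`. -/
lemma Δ_eq_mul_I {α τ : ℝ} (hτ : 0 ≤ τ) {l : ℝ≥0} (hl : (l : ℝ) = (1 / 2 - α) ^ 2 + τ ^ 2) :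
    Δ α l = τ * Complex.I := by
  rw [Δ, hl, sub_add_cancel_left, Complex.ofReal_neg, Complex.sqrt_neg_of_nonneg,
    Complex.sqrt_of_nonneg, Complex.ofReal_re, Real.sqrt_sq hτ, mul_comm]
  all_goals exact_mod_cast sq_nonneg τ

lemma charFun_logMeasure_eq_transform {α : ℝ} (hα : 0 < 1 / 2 - α) (μ : Measure ℝ≥0)
    [IsFiniteMeasure μ] {τ : ℝ} (hτ : 0 ≤ τ) {l : ℝ≥0} (hl : (l : ℝ) = (1 / 2 - α) ^ 2 + τ ^ 2) :
    charFun (logMeasure (1 / 2 - α) μ) τ =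
      Complex.Gamma ((1 / 2 - α : ℝ) + τ * Complex.I) * transform α μ l := by
  rw [charFun_logMeasure hα, transform, ← integral_const_mul]
  refine integral_congr_ae (.of_forall fun x => ?_)
  have h := isSpectral_Δ hα l
  have hG := Complex.Gamma_ne_zero_of_re_pos (h.re_add_pos hα)
  simp only [bW_eq_profile hα h, profile]
  rw [← Δ_eq_mul_I hτ hl, mul_inv_cancel_left₀ hG]

lemma logMeasure_eq_of_transform_eq {α : ℝ} (hα : 0 < 1 / 2 - α) {μ₁ μ₂ : Measure ℝ≥0}
    [IsFiniteMeasure μ₁] [IsFiniteMeasure μ₂] (h : ∀ l, transform α μ₁ l = transform α μ₂ l) :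
    logMeasure (1 / 2 - α) μ₁ = logMeasure (1 / 2 - α) μ₂ := by
  have := isFiniteMeasure_logMeasure hα μ₁
  have := isFiniteMeasure_logMeasure hα μ₂
  have key : ∀ τ : ℝ, 0 ≤ τ → charFun (logMeasure (1 / 2 - α) μ₁) τ =
      charFun (logMeasure (1 / 2 - α) μ₂) τ := by
    intro τ hτ
    obtain ⟨l, hl⟩ : ∃ l : ℝ≥0, (l : ℝ) = (1 / 2 - α) ^ 2 + τ ^ 2 :=
      ⟨Real.toNNReal _, Real.coe_toNNReal _ (by positivity)⟩
    rw [charFun_logMeasure_eq_transform hα μ₁ hτ hl, charFun_logMeasure_eq_transform hα μ₂ hτ hl, h]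
  refine Measure.ext_of_charFun (funext fun τ => ?_)
  rcases le_total 0 τ with hτ | hτ
  · exact key τ hτ
  · have := key (-τ) (by linarith)
    rw [charFun_neg, charFun_neg] at this
    exact (starRingEnd ℂ).injective this

/-! ### Injectivity of the transform -/

/-- `∫ e^{-2x²u²} μ(dx)`, the Laplace transform of the image of `μ` under `x ↦ x²`, at `2u²`. -/
noncomputable def sqLaplace (μ : Measure ℝ≥0) (u : ℝ) : ℝ :=
  ∫ x : ℝ≥0, Real.exp (-(2 * (x : ℝ) ^ 2 * u ^ 2)) ∂μ

lemma continuous_sqLaplace (μ : Measure ℝ≥0) [IsFiniteMeasure μ] : Continuous (sqLaplace μ) := by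
  refine continuous_of_dominated (bound := fun _ => 1)
    (fun u => (by fun_prop : Continuous fun x : ℝ≥0 =>
      Real.exp (-(2 * (x : ℝ) ^ 2 * u ^ 2))).aestronglyMeasurable) (fun u => .of_forall fun x => ?_)
    (integrable_const _) (.of_forall fun x => by fun_prop)
  rw [Real.norm_of_nonneg (by positivity), Real.exp_le_one_iff]
  have : 0 ≤ 2 * (x : ℝ) ^ 2 * u ^ 2 := by positivity
  linarith

lemma sqLaplace_nonneg (μ : Measure ℝ≥0) (u : ℝ) : 0 ≤ sqLaplace μ u :=
  integral_nonneg fun _ => (Real.exp_pos _).le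

/-- The integrand `e^{-cu} u^{2a-1} e^{-2x²u²}` at `p = (x, u)`; its integral in `u` is a parabolic
cylinder function. -/
noncomputable def parabolicKernel (a c : ℝ) (p : ℝ≥0 × ℝ) : ℝ :=
  Real.exp (-(c * p.2)) * p.2 ^ (2 * a - 1) * Real.exp (-(2 * (p.1 : ℝ) ^ 2 * p.2 ^ 2))

@[fun_prop]
lemma measurable_parabolicKernel (a c : ℝ) : Measurable (parabolicKernel a c) := by
  unfold parabolicKernel; fun_prop

lemma norm_parabolicKernel_le (a : ℝ) {c : ℝ} (hc : 1 ≤ c) {p : ℝ≥0 × ℝ} (hp : 0 < p.2) :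
    ‖parabolicKernel a c p‖ ≤ Real.exp (-p.2) * p.2 ^ (2 * a - 1) := by
  rw [parabolicKernel, Real.norm_of_nonneg (by positivity)]
  refine mul_le_of_le_one_right (by positivity) ?_ |>.trans ?_
  · rw [Real.exp_le_one_iff]
    have : 0 ≤ 2 * (p.1 : ℝ) ^ 2 * p.2 ^ 2 := by positivity
    linarith
  · gcongr
    nlinarith

lemma integrable_parabolicKernel {a c : ℝ} (ha : 0 < a) (hc : 1 ≤ c) (μ : Measure ℝ≥0)
    [IsFiniteMeasure μ] : Integrable (parabolicKernel a c) (baseMeasure μ) :=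
  integrable_baseMeasure_of_le (q := 2 * a) (by positivity) (by fun_prop)
    fun _ hp => norm_parabolicKernel_le a hc hp

lemma integral_parabolicKernel_eq_sqLaplace {a c : ℝ} (ha : 0 < a) (hc : 1 ≤ c) (μ : Measure ℝ≥0)
    [IsFiniteMeasure μ] :
    ∫ p, parabolicKernel a c p ∂baseMeasure μ =
      ∫ u in Set.Ioi (0 : ℝ), Real.exp (-(c * u)) * u ^ (2 * a - 1) * sqLaplace μ u := by
  rw [baseMeasure, integral_prod_symm _ (integrable_parabolicKernel ha hc μ)]
  refine integral_congr_ae (.of_forall fun u => ?_)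
  simp only [parabolicKernel, sqLaplace, ← integral_const_mul]

/-- The integral of `q^a e^{-r²q}`, `q = e^t`, against `logMeasure a μ`. The factors `(1+2x²s)^{±a}`
cancel, and `u = rs` turns the exponent `-(1+r²) s - 2r²x²s²` into `-cu - 2x²u²` with
`c = r + 1/r`. -/
lemma integral_logMeasure_exp_mul_exp {a r c : ℝ} (ha : 0 < a) (hr : 0 < r) (hc : 1 + r ^ 2 = c * r)
    (hc1 : 1 ≤ c) (μ : Measure ℝ≥0) [IsFiniteMeasure μ] :
    ∫ t, Real.exp (a * t) * Real.exp (-(r ^ 2 * Real.exp t)) ∂logMeasure a μ =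
      (r ^ (2 * a))⁻¹ * ∫ p, parabolicKernel a c p ∂baseMeasure μ := by
  have hpt : ∀ p : ℝ≥0 × ℝ, 0 < p.2 → logDensity a p •
      (Real.exp (a * logMap p) * Real.exp (-(r ^ 2 * Real.exp (logMap p)))) =
      (r ^ (2 * a - 1))⁻¹ * parabolicKernel a c (p.1, r * p.2) := by
    rintro ⟨x, s⟩ hs
    have hs : 0 < s := hs
    have hq : 0 < 1 + 2 * (x : ℝ) ^ 2 * s := by positivity
    have hsq : 0 < s * (1 + 2 * (x : ℝ) ^ 2 * s) := by positivity
    have e1 : Real.exp (a * logMap (x, s)) = s ^ a * (1 + 2 * (x : ℝ) ^ 2 * s) ^ a := by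
      rw [← Real.mul_rpow hs.le hq.le, Real.rpow_def_of_pos hsq, mul_comm]
      rfl
    have e2 : Real.exp (logMap (x, s)) = s * (1 + 2 * (x : ℝ) ^ 2 * s) := Real.exp_log hsq
    have e3 : (1 + 2 * (x : ℝ) ^ 2 * s) ^ (-a) * (1 + 2 * (x : ℝ) ^ 2 * s) ^ a = 1 := by
      rw [← Real.rpow_add hq]; simp
    have e4 : s ^ (a - 1) * s ^ a = s ^ (2 * a - 1) := by
      rw [← Real.rpow_add hs]; ring_nf
    have e5 : Real.exp (-s) * Real.exp (-(r ^ 2 * (s * (1 + 2 * (x : ℝ) ^ 2 * s)))) =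
        Real.exp (-(c * (r * s))) * Real.exp (-(2 * (x : ℝ) ^ 2 * (r * s) ^ 2)) := by
      rw [← Real.exp_add, ← Real.exp_add]
      congr 1
      linear_combination (-s) * hc
    have e6 : (r ^ (2 * a - 1))⁻¹ * (r * s) ^ (2 * a - 1) = s ^ (2 * a - 1) := by
      rw [Real.mul_rpow hr.le hs.le, inv_mul_cancel_left₀ (by positivity)]
    rw [e1, e2, logDensity, parabolicKernel, smul_eq_mul]
    calc _ = (Real.exp (-s) * Real.exp (-(r ^ 2 * (s * (1 + 2 * (x : ℝ) ^ 2 * s))))) *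
          (s ^ (a - 1) * s ^ a) *
          ((1 + 2 * (x : ℝ) ^ 2 * s) ^ (-a) * (1 + 2 * (x : ℝ) ^ 2 * s) ^ a) := by ring
      _ = _ := by rw [e3, e4, e5, ← e6]; ring
  have hint : Integrable (fun p => logDensity a p •
      (Real.exp (a * logMap p) * Real.exp (-(r ^ 2 * Real.exp (logMap p))))) (baseMeasure μ) := by
    refine integrable_baseMeasure_of_le (q := 2 * a) (by positivity)
      (Measurable.aestronglyMeasurable (by fun_prop)) fun p hp => ?_
    have hp2 : 0 < r * p.2 := by positivity
    rw [hpt p hp, parabolicKernel, Real.mul_rpow hr.le hp.le, Real.norm_of_nonneg (by positivity)]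
    have e : (r ^ (2 * a - 1))⁻¹ * (Real.exp (-(c * (r * p.2))) *
        (r ^ (2 * a - 1) * p.2 ^ (2 * a - 1)) * Real.exp (-(2 * (p.1 : ℝ) ^ 2 * (r * p.2) ^ 2))) =
        Real.exp (-(c * (r * p.2))) * p.2 ^ (2 * a - 1) *
          Real.exp (-(2 * (p.1 : ℝ) ^ 2 * (r * p.2) ^ 2)) := by
      have : r ^ (2 * a - 1) ≠ 0 := by positivity
      field_simp
    rw [e]
    refine (mul_le_of_le_one_right (by positivity) ?_).trans ?_
    · rw [Real.exp_le_one_iff]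
      have : 0 ≤ 2 * (p.1 : ℝ) ^ 2 * (r * p.2) ^ 2 := by positivity
      linarith
    · gcongr
      rw [← mul_assoc, ← hc]
      nlinarith [mul_pos (pow_pos hr 2) hp]
  rw [integral_logMeasure (by fun_prop), baseMeasure, integral_prod _ hint,
    integral_prod _ (integrable_parabolicKernel ha hc1 μ), ← integral_const_mul]
  refine integral_congr_ae (.of_forall fun x => ?_)
  have hscale := integral_comp_mul_left_Ioi (fun u => parabolicKernel a c (x, u)) 0 hr
  rw [mul_zero, smul_eq_mul] at hscale
  have hr' : (r ^ (2 * a - 1))⁻¹ * r⁻¹ = (r ^ (2 * a))⁻¹ := by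
    rw [← mul_inv, ← Real.rpow_add_one hr.ne', sub_add_cancel]
  calc _ = ∫ s in Set.Ioi (0 : ℝ), (r ^ (2 * a - 1))⁻¹ * parabolicKernel a c (x, r * s) :=
        setIntegral_congr_fun measurableSet_Ioi fun s hs => hpt (x, s) hs
    _ = _ := by rw [integral_const_mul, hscale, ← mul_assoc, hr']

/-- Every `c ≥ 2` has the form `r + 1/r` with `r > 0`. -/
lemma integral_parabolicKernel_eq_of_logMeasure_eq {a c : ℝ} (ha : 0 < a) (hc : 2 ≤ c)
    {μ₁ μ₂ : Measure ℝ≥0} [IsFiniteMeasure μ₁] [IsFiniteMeasure μ₂]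
    (h : logMeasure a μ₁ = logMeasure a μ₂) :
    ∫ p, parabolicKernel a c p ∂baseMeasure μ₁ = ∫ p, parabolicKernel a c p ∂baseMeasure μ₂ := by
  have hd : 0 ≤ c ^ 2 - 4 := by nlinarith
  -- the larger root of `r ^ 2 - c * r + 1`
  set r : ℝ := (c + √(c ^ 2 - 4)) / 2 with hr
  have hr0 : 0 < r := by positivity
  have hrc : 1 + r ^ 2 = c * r := by
    rw [hr]
    linear_combination Real.sq_sqrt hd / 4
  have h1 := integral_logMeasure_exp_mul_exp ha hr0 hrc (by linarith) μ₁
  rw [h, integral_logMeasure_exp_mul_exp ha hr0 hrc (by linarith) μ₂] at h1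
  exact (mul_left_cancel₀ (by positivity) h1).symm

/-- The measure `e^{-2u} u^{2a-1} sqLaplace μ u du` on `(0, ∞)`. The factor `e^{-2u}` shifts the
parameters `c ≥ 2` to Laplace parameters `k ≥ 0`. -/
noncomputable def sqLaplaceMeasure (a : ℝ) (μ : Measure ℝ≥0) : Measure ℝ :=
  (volume.restrict (Set.Ioi 0)).withDensity fun u =>
    ENNReal.ofReal (Real.exp (-(2 * u)) * u ^ (2 * a - 1) * sqLaplace μ u)

lemma integrable_sqLaplaceDensity {a : ℝ} (ha : 0 < a) (μ : Measure ℝ≥0) [IsFiniteMeasure μ] :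
    Integrable (fun u => Real.exp (-(2 * u)) * u ^ (2 * a - 1) * sqLaplace μ u)
      (volume.restrict (Set.Ioi 0)) := by
  have h := (integrable_parabolicKernel ha one_le_two μ).integral_prod_right
  simpa only [parabolicKernel, integral_const_mul, sqLaplace] using h

lemma measurable_sqLaplaceDensity (a : ℝ) (μ : Measure ℝ≥0) [IsFiniteMeasure μ] :
    Measurable
      (fun u => ENNReal.ofReal (Real.exp (-(2 * u)) * u ^ (2 * a - 1) * sqLaplace μ u)) := by
  have := (continuous_sqLaplace μ).measurable
  fun_prop

lemma integral_sqLaplaceMeasure {a : ℝ} (ha : 0 < a) (μ : Measure ℝ≥0) [IsFiniteMeasure μ]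
    (k : ℝ≥0) :
    ∫ u, Real.exp (-((k : ℝ) * u)) ∂sqLaplaceMeasure a μ =
      ∫ p, parabolicKernel a (2 + k) p ∂baseMeasure μ := by
  rw [integral_parabolicKernel_eq_sqLaplace ha (by linarith [k.coe_nonneg]), sqLaplaceMeasure,
    integral_withDensity_eq_integral_toReal_smul (measurable_sqLaplaceDensity a μ) (by simp)]
  refine setIntegral_congr_fun measurableSet_Ioi fun u hu => ?_
  have hu : 0 < u := hu
  have hL := sqLaplace_nonneg μ u
  simp only [smul_eq_mul]
  rw [ENNReal.toReal_ofReal (by positivity),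
    show -((2 + (k : ℝ)) * u) = -(2 * u) + -((k : ℝ) * u) by ring, Real.exp_add]
  ring

lemma sqLaplace_eq_of_logMeasure_eq {a : ℝ} (ha : 0 < a)
    {μ₁ μ₂ : Measure ℝ≥0} [IsFiniteMeasure μ₁] [IsFiniteMeasure μ₂]
    (h : logMeasure a μ₁ = logMeasure a μ₂) :
    Set.EqOn (sqLaplace μ₁) (sqLaplace μ₂) (Set.Ici 0) := by
  have hfin : ∀ μ : Measure ℝ≥0, [IsFiniteMeasure μ] → IsFiniteMeasure (sqLaplaceMeasure a μ) :=
    fun μ _ => isFiniteMeasure_withDensity_ofReal (integrable_sqLaplaceDensity ha μ).2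
  have hpos : ∀ μ : Measure ℝ≥0, ∀ᵐ u ∂sqLaplaceMeasure a μ, 0 ≤ u := fun μ =>
    (withDensity_absolutelyContinuous _ _).ae_le <| by
      filter_upwards [ae_restrict_mem measurableSet_Ioi] with u hu using le_of_lt hu
  have := hfin μ₁
  have := hfin μ₂
  have hR : sqLaplaceMeasure a μ₁ = sqLaplaceMeasure a μ₂ := by
    refine ext_of_integral_exp_neg_mul_eq_of_ae_nonneg (hpos μ₁) (hpos μ₂) fun k => ?_
    rw [integral_sqLaplaceMeasure ha, integral_sqLaplaceMeasure ha,
      integral_parabolicKernel_eq_of_logMeasure_eq ha (by linarith [k.coe_nonneg]) h]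
  rw [sqLaplaceMeasure, sqLaplaceMeasure, withDensity_eq_iff_of_sigmaFinite
    (measurable_sqLaplaceDensity a μ₁).aemeasurable
    (measurable_sqLaplaceDensity a μ₂).aemeasurable] at hR
  have hae : sqLaplace μ₁ =ᵐ[volume.restrict (Set.Ioi 0)] sqLaplace μ₂ := by
    filter_upwards [hR, ae_restrict_mem measurableSet_Ioi] with u hu hu0
    have hu0 : 0 < u := hu0
    have h1 := sqLaplace_nonneg μ₁ u
    have h2 := sqLaplace_nonneg μ₂ u
    rw [ENNReal.ofReal_eq_ofReal_iff (by positivity) (by positivity)] at hu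
    exact mul_left_cancel₀ (by positivity) hu
  have hI := Measure.eqOn_open_of_ae_eq hae isOpen_Ioi (continuous_sqLaplace μ₁).continuousOn
    (continuous_sqLaplace μ₂).continuousOn
  rw [← closure_Ioi]
  exact hI.closure (continuous_sqLaplace μ₁) (continuous_sqLaplace μ₂)

lemma ext_of_transform_eq {α : ℝ} (hα : 0 < 1 / 2 - α) {μ₁ μ₂ : Measure ℝ≥0}
    [IsFiniteMeasure μ₁] [IsFiniteMeasure μ₂] (h : ∀ l, transform α μ₁ l = transform α μ₂ l) :
    μ₁ = μ₂ := by
  have hL := sqLaplace_eq_of_logMeasure_eq hα (logMeasure_eq_of_transform_eq hα h)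
  refine ext_of_integral_exp_neg_mul_eq (g := fun x : ℝ≥0 => (x : ℝ) ^ 2) (by fun_prop)
    (fun x => by positivity) ?_ fun k => ?_
  · intro x y hxy
    exact NNReal.coe_injective ((sq_eq_sq₀ x.coe_nonneg y.coe_nonneg).1 hxy)
  · have e := hL (Set.mem_Ici.2 (Real.sqrt_nonneg ((k : ℝ) / 2)))
    simp only [sqLaplace, Real.sq_sqrt (show 0 ≤ (k : ℝ) / 2 by positivity)] at e
    simp only [show ∀ x : ℝ≥0, 2 * (x : ℝ) ^ 2 * ((k : ℝ) / 2) = k * (x : ℝ) ^ 2 by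
      intro x; ring] at e
    exact e

/-! ### The continuity theorem -/

lemma transform_zero {α : ℝ} (hα : 0 < 1 / 2 - α) (μ : FiniteMeasure ℝ≥0) :
    transform α (μ : Measure ℝ≥0) 0 = ((μ.mass : ℝ) : ℂ) := by
  have h : IsSpectral (1 / 2 - α) (Δ α 0) 0 := by simpa using isSpectral_Δ hα 0
  have h1 : ∀ x : ℝ≥0, bW α (Δ α 0) x = 1 := fun x => by
    rw [bW_eq_profile hα h, profile_of_zero hα h]
  simp only [transform, h1, integral_const, Complex.real_smul, mul_one]
  rfl

lemma exists_norm_bW_le {α : ℝ} (hα : 0 < 1 / 2 - α) {l : ℝ≥0} (hl : 0 < l) :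
    ∃ R : ℝ≥0, ∀ x, R < x → ‖bW α (Δ α l) x‖ ≤ 1 / 2 := by
  have hre : (Δ α l).re < 1 / 2 - α := by
    rw [Δ, Complex.re_sqrt_ofReal, Real.sqrt_lt' hα]
    have : (0 : ℝ) < l := hl
    linarith
  have h := (tendsto_profile_atTop hα (isSpectral_Δ hα l) hre).norm
  rw [norm_zero] at h
  obtain ⟨y, hy⟩ := eventually_atTop.1
    (h.eventually (ge_mem_nhds (show (0 : ℝ) < 1 / 2 by norm_num)))
  refine ⟨Real.toNNReal (max 1 y), fun x hx => ?_⟩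
  have hx' : max 1 y < x := (Real.toNNReal_lt_iff_lt_coe (by positivity)).1 hx
  have h1 : 1 < (x : ℝ) := (le_max_left _ _).trans_lt hx'
  have h2 : y < (x : ℝ) := (le_max_right _ _).trans_lt hx'
  rw [bW_eq_profile hα (isSpectral_Δ hα l)]
  exact hy _ (by nlinarith)

/-- Since `Re 𝑾 ≤ 1` everywhere and `Re 𝑾 ≤ 1/2` beyond `R`, the mass beyond `R` is at most twice
`∫ (1 - Re 𝑾) dμ`. -/
lemma measureReal_Ioi_le {α : ℝ} (hα : 0 < 1 / 2 - α) (μ : FiniteMeasure ℝ≥0) {l R : ℝ≥0}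
    (hR : ∀ x, R < x → ‖bW α (Δ α l) x‖ ≤ 1 / 2) :
    (μ : Measure ℝ≥0).real (Set.Ioi R) ≤
      2 * ((transform α (μ : Measure ℝ≥0) 0).re - (transform α (μ : Measure ℝ≥0) l).re) := by
  have hi := integrable_bW hα μ l
  have hire : Integrable (fun x => (bW α (Δ α l) x).re) (μ : Measure ℝ≥0) := hi.re
  have hre : (transform α (μ : Measure ℝ≥0) l).re = ∫ x, (bW α (Δ α l) x).re ∂(μ : Measure ℝ≥0) :=
    (integral_re hi).symm
  have h0 : (transform α (μ : Measure ℝ≥0) 0).re = ∫ _, (1 : ℝ) ∂(μ : Measure ℝ≥0) := by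
    rw [transform_zero hα, Complex.ofReal_re, integral_const, smul_eq_mul, mul_one]
    rfl
  have hind : (μ : Measure ℝ≥0).real (Set.Ioi R) =
      ∫ x, (Set.Ioi R).indicator (fun _ => (1 : ℝ)) x ∂(μ : Measure ℝ≥0) := by
    rw [integral_indicator_const _ measurableSet_Ioi, smul_eq_mul, mul_one]
  rw [hre, h0, ← integral_sub (integrable_const _) hire, ← integral_const_mul, hind]
  refine integral_mono ((integrable_const _).indicator measurableSet_Ioi)
    (((integrable_const _).sub hire).const_mul _) fun x => ?_
  change (Set.Ioi R).indicator (fun _ => (1 : ℝ)) x ≤ 2 * (1 - (bW α (Δ α l) x).re)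
  by_cases hx : x ∈ Set.Ioi R
  · rw [Set.indicator_of_mem hx]
    linarith [(Complex.re_le_norm (bW α (Δ α l) x)).trans (hR x hx)]
  · rw [Set.indicator_of_notMem hx]
    linarith [(Complex.re_le_norm (bW α (Δ α l) x)).trans (norm_bW_le_one hα l x)]

lemma exists_measure_Ioi_le (μ : FiniteMeasure ℝ≥0) {ε : ℝ≥0} (hε : 0 < ε) :
    ∃ R : ℝ≥0, μ (Set.Ioi R) ≤ ε := by
  obtain ⟨K, hK, h⟩ := isTightMeasureSet_iff_exists_isCompact_measure_compl_le.1
    (isTightMeasureSet_singleton (μ := (μ : Measure ℝ≥0))) ε (by exact_mod_cast hε)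
  obtain ⟨R, hR⟩ := hK.bddAbove
  refine ⟨R, ?_⟩
  have h1 := h _ rfl
  rw [← FiniteMeasure.ennreal_coeFn_eq_coeFn_toMeasure] at h1
  refine (FiniteMeasure.apply_mono μ ?_).trans (by exact_mod_cast h1)
  intro x hx hxK
  exact absurd (hR hxK) (not_le.2 hx)

/-- Tightness: for small `l > 0` the bound `2 (μ̂_n(0) - Re μ̂_n(l))` on the tails has a limit below
`ε`, and the finitely many remaining measures are tight one by one. -/
lemma exists_forall_measure_Ioi_le {α : ℝ} (hα : 0 < 1 / 2 - α) {μs : ℕ → FiniteMeasure ℝ≥0}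
    {f : ℝ≥0 → ℝ} (hf : ContinuousAt f 0)
    (h : ∀ l : ℝ≥0, Tendsto (fun n => transform α (μs n : Measure ℝ≥0) l) atTop
      (𝓝 ((f l : ℝ) : ℂ))) {ε : ℝ≥0} (hε : 0 < ε) :
    ∃ R : ℝ≥0, ∀ n, μs n (Set.Ioi R) ≤ ε := by
  have hε' : (0 : ℝ) < ε := hε
  obtain ⟨l, hl, hl0⟩ : ∃ l : ℝ≥0, 2 * (f 0 - f l) < ε ∧ 0 < l := by
    have h1 : Tendsto (fun l => 2 * (f 0 - f l)) (𝓝[>] 0) (𝓝 (2 * (f 0 - f 0))) :=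
      ((tendsto_const_nhds.sub hf.tendsto).const_mul 2).mono_left nhdsWithin_le_nhds
    rw [sub_self, mul_zero] at h1
    exact ((h1.eventually (gt_mem_nhds hε')).and
      (self_mem_nhdsWithin (s := Set.Ioi (0 : ℝ≥0)))).exists
  obtain ⟨R, hR⟩ := exists_norm_bW_le hα hl0
  have hre : ∀ l, Tendsto (fun n => (transform α (μs n : Measure ℝ≥0) l).re) atTop (𝓝 (f l)) :=
    fun l => by simpa [Function.comp_def] using (Complex.continuous_re.tendsto _).comp (h l)
  have hlim := ((hre 0).sub (hre l)).const_mul 2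
  obtain ⟨N, hN⟩ := eventually_atTop.1 (hlim.eventually (gt_mem_nhds hl))
  choose S hS using fun n => exists_measure_Ioi_le (μs n) hε
  obtain ⟨M, hM⟩ := ((Finset.range N).image S).exists_le
  refine ⟨max R M, fun n => ?_⟩
  rcases lt_or_ge n N with hn | hn
  · exact (FiniteMeasure.apply_mono _ (Set.Ioi_subset_Ioi ((hM _ (Finset.mem_image_of_mem S
      (Finset.mem_range.2 hn))).trans (le_max_right _ _)))).trans (hS n)
  · refine (FiniteMeasure.apply_mono _ (Set.Ioi_subset_Ioi (le_max_left _ _))).trans ?_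
    exact NNReal.coe_le_coe.1 ((measureReal_Ioi_le hα (μs n) hR).trans (hN n hn).le)

theorem exists_tendsto_of_tendsto_transform {α : ℝ} (hα : 0 < 1 / 2 - α)
    {μs : ℕ → FiniteMeasure ℝ≥0} {f : ℝ≥0 → ℝ} (hf : ContinuousAt f 0)
    (h : ∀ l : ℝ≥0, Tendsto (fun n => transform α (μs n : Measure ℝ≥0) l) atTop
      (𝓝 ((f l : ℝ) : ℂ))) :
    ∃ μ : FiniteMeasure ℝ≥0, Tendsto μs atTop (𝓝 μ) ∧
      ∀ l : ℝ≥0, transform α (μ : Measure ℝ≥0) l = ((f l : ℝ) : ℂ) := by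
  obtain ⟨u, -, hu0, hu⟩ := exists_seq_strictAnti_tendsto (0 : ℝ≥0)
  choose R hR using fun m => exists_forall_measure_Ioi_le hα hf h (hu0 m)
  have hmass : Tendsto (fun n => ((μs n).mass : ℝ)) atTop (𝓝 (f 0)) := by
    have := (Complex.continuous_re.tendsto _).comp (h 0)
    simpa [Function.comp_def, transform_zero hα] using this
  obtain ⟨C, hC⟩ := hmass.bddAbove_range
  have hcomp := isCompact_setOfPred_finiteMeasure_mass_le_compl_isCompact_le (E := ℝ≥0)
    (K := fun m => Set.Icc 0 (R m)) C.toNNReal hu (fun m => isCompact_Icc)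
    (Or.inl inferInstance)
  have hmem : ∀ n, μs n ∈ {μ : FiniteMeasure ℝ≥0 |
      μ.mass ≤ C.toNNReal ∧ ∀ m, μ (Set.Icc 0 (R m))ᶜ ≤ u m} := by
    refine fun n => ⟨?_, fun m => ?_⟩
    · exact NNReal.le_toNNReal_of_coe_le (hC ⟨n, rfl⟩)
    · refine (FiniteMeasure.apply_mono _ ?_).trans (hR m n)
      intro x hx
      by_contra hxR
      exact hx ⟨zero_le, not_lt.1 hxR⟩
  have hlim : ∀ μ : FiniteMeasure ℝ≥0, MapClusterPt μ atTop μs →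
      ∀ l, transform α (μ : Measure ℝ≥0) l = ((f l : ℝ) : ℂ) := by
    intro μ hμ l
    have hc : ContinuousAt (fun ν : FiniteMeasure ℝ≥0 => transform α (ν : Measure ℝ≥0) l) μ :=
      tendsto_transform hα tendsto_id l
    have h1 : ClusterPt _ _ := hμ.continuousAt_comp hc
    have h2 := h1.mono (h l)
    exact eq_of_nhds_neBot h2
  obtain ⟨μ, -, hμ⟩ := hcomp.exists_mapClusterPt (f := atTop) (u := μs)
    (tendsto_principal.2 (.of_forall hmem))
  refine ⟨μ, hcomp.tendsto_nhds_of_unique_mapClusterPt (.of_forall hmem) fun ν _ hν => ?_,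
    hlim μ hμ⟩
  exact FiniteMeasure.toMeasure_injective (ext_of_transform_eq hα fun l => by
    rw [hlim ν hν l, hlim μ hμ l])

end IndexWhittaker

theorem mainTheorem4 (α : ℝ) (hα : α < 1 / 2) :
    -- the transform is well defined
    (∀ (μ : FiniteMeasure ℝ≥0) (l : ℝ≥0),
      Integrable (IndexWhittaker.bW α (IndexWhittaker.Δ α l)) (μ : Measure ℝ≥0)) ∧
    -- (i) uniform continuity and uniform equicontinuity
    (∀ μ : FiniteMeasure ℝ≥0,
      UniformContinuous (IndexWhittaker.transform α (μ : Measure ℝ≥0))) ∧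
    (∀ (J : Type*) (μ : J → ProbabilityMeasure ℝ≥0),
      IsTightMeasureSet
        (Set.range fun j => (μ j : Measure ℝ≥0).restrict (Set.Ioi (0 : ℝ≥0))) →
      UniformEquicontinuous fun j => IndexWhittaker.transform α (μ j : Measure ℝ≥0)) ∧
    -- (ii) uniqueness
    (∀ μ₁ μ₂ : FiniteMeasure ℝ≥0,
      (∀ l : ℝ≥0, IndexWhittaker.transform α (μ₁ : Measure ℝ≥0) l =
        IndexWhittaker.transform α (μ₂ : Measure ℝ≥0) l) →
      μ₁ = μ₂) ∧
    -- (iii) weak convergence implies locally uniform convergence of the transforms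
    (∀ (μs : ℕ → FiniteMeasure ℝ≥0) (μ : FiniteMeasure ℝ≥0),
      Tendsto μs atTop (𝓝 μ) →
      ∀ K : Set ℝ≥0, IsCompact K →
        TendstoUniformlyOn (fun n => IndexWhittaker.transform α (μs n : Measure ℝ≥0))
          (IndexWhittaker.transform α (μ : Measure ℝ≥0)) atTop K) ∧
    -- (iv) continuity theorem
    (∀ (μs : ℕ → FiniteMeasure ℝ≥0) (f : ℝ≥0 → ℝ),
      (∀ᶠ l in 𝓝 (0 : ℝ≥0), ContinuousAt f l) →
      (∀ l : ℝ≥0, Tendsto (fun n => IndexWhittaker.transform α (μs n : Measure ℝ≥0) l) atTop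
        (𝓝 ((f l : ℝ) : ℂ))) →
      ∃ μ : FiniteMeasure ℝ≥0, Tendsto μs atTop (𝓝 μ) ∧
        ∀ l : ℝ≥0, IndexWhittaker.transform α (μ : Measure ℝ≥0) l = ((f l : ℝ) : ℂ)) := by
  have hα' : 0 < 1 / 2 - α := sub_pos.2 hα
  refine ⟨fun μ l => IndexWhittaker.integrable_bW hα' μ l,
    fun μ => IndexWhittaker.uniformContinuous_transform hα' μ, fun J μ hμ => ?_,
    fun μ₁ μ₂ h => FiniteMeasure.toMeasure_injective (IndexWhittaker.ext_of_transform_eq hα' h),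
    fun μs μ h K hK => IndexWhittaker.tendstoUniformlyOn_transform hα' h hK,
    fun μs f hf h => IndexWhittaker.exists_tendsto_of_tendsto_transform hα' hf.self_of_nhds h⟩
  exact IndexWhittaker.uniformEquicontinuous_transform hα' (fun j => (μ j).toFiniteMeasure)
    fun ε hε => IndexWhittaker.exists_modulus_lt_of_isTightMeasureSet μ hμ hε
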